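/- For every $k\in\mathbb N$ (the stage; it is suppressed in the notation, and all quantities below may depend on it) consider a split-plot design with $a$ independent groups of $d$-dimensional observations: independent random vectors $X_{i,j}\sim\mathcal N_d(\mu_i,\Sigma_i)$, $j=1,\dots,n_i$, $i=1,\dots,a$, with positive definite $\Sigma_i$. Put $N=\sum_{i=1}^a n_i$, $\mu=(\mu_1^\top,\dots,\mu_a^\top)^\top$, and let $T=T_W\otimes T_S\neq 0$ with symmetric idempotent matrices $T_W\in\mathbb R^{a\times a}$ and $T_S\in\mathbb R^{d\times d}$. Let $\overline X$ be the stacked vector of the group means $\overline X_i=n_i^{-1}\sum_j X_{i,j}$, let $Q_N=N\,\overline X^\top T\,\overline X$, and let $V_N=\bigoplus_{i=1}^a\frac N{n_i}\Sigma_i$. Let $\lambda_1\ge\dots\ge\lambda_{ad}$ be the eigenvalues of $TV_NT$, $\beta_s=\lambda_s/\sqrt{\sum_{\ell=1}^{ad}\lambda_\ell^2}$ for $s\le ad$, and $\beta_s=0$ for $s>ad$. Put $$\widetilde W_N=\frac{Q_N-\mathbb E(Q_N)}{\operatorname{Var}(Q_N)^{1/2}},\qquad W_N=\frac{Q_N-\sum_{i=1}^a\frac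 N{n_i}(T_W)_{ii}A_{i,1}}{(2A_4)^{1/2}},$$ where $$A_{i,1}=\frac1{2\binom{n_i}2}\sum_{\ell_1>\ell_2}(X_{i,\ell_1}-X_{i,\ell_2})^\top T_S(X_{i,\ell_1}-X_{i,\ell_2}),$$ $$A_{i,r,2}=\frac1{4\binom{n_i}2\binom{n_r}2}\sum_{\ell_1>\ell_2}\ \sum_{k_1>k_2}\bigl[(X_{i,\ell_1}-X_{i,\ell_2})^\top T_S(X_{r,k_1}-X_{r,k_2})\bigr]^2,$$ $$A_{i,3}=\frac1{24\binom{n_i}4}\sum_{\substack{\ell_1>\ell_2,\ k_1>k_2\\ \ell_1,\ell_2,k_1,k_2\text{ pairwise different}}}\bigl[(X_{i,\ell_1}-X_{i,\ell_2})^\top T_S(X_{i,k_1}-X_{i,k_2})\bigr]^2,$$ $$A_4=\sum_{i=1}^a\Bigl(\frac N{n_i}\Bigr)^2(T_W)_{ii}^2A_{i,3}+2\sum_{i=1}^a\sum_{r<i}\frac{N^2}{n_in_r}(T_W)_{ir}^2A_{i,r,2}.$$ Suppose that the null hypothesis $H_0(T):T\mu=0$ holds at every stage and that, as $k\to\infty$,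 one of the following holds: $a$ is fixed and $\min(d,n_1,\dots,n_a)\to\infty$; or $d$ is fixed and $\min(a,n_1,\dots,n_a)\to\infty$; or $\min(a,d,n_1,\dots,n_a)\to\infty$. Let $C_1,C_2,\dots$ be independent $\chi^2_1$-distributed random variables. Then $W_N$ has the same limit in distribution as $\widetilde W_N$ in each of the following cases: (a) if $\beta_1\to0$, then $\widetilde W_N$ and $W_N$ both converge in distribution to $\mathcal N(0,1)$; (b) if $\beta_1\to1$, then $\widetilde W_N$ and $W_N$ both converge in distribution to $(C_1-1)/\sqrt2$; (c) if $\beta_s\to b_s$ for every $s\in\mathbb N$, where $(b_s)_s$ is a decreasing sequence in $[0,1]$ with $\sum_{s=1}^\infty b_s^2=1$, then the series $\sum_{s=1}^\infty b_s(C_s-1)/\sqrt2$ converges almost surely, and $\widetilde W_N$ and $W_N$ both converge in distribution to its sum. -/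

import Mathlib

open MeasureTheory ProbabilityTheory Filter Topology
open scoped Matrix Kronecker

/-- One stage of the (triangular array of) heteroscedastic split-plot designs: `a` groups of
`d`-dimensional normal observations, `n i` of them in group `i`, with group means `mean i`, positive
definite group covariance matrices `cov i`, and a hypothesis matrix `T = TW ⊗ TS` which is the
Kronecker product of a whole-plot projection `TW` and a subplot projection `TS` (symmetric and
idempotent matrices). The trivial hypothesis `T = 0`, for which the test statistics are `0 / 0`,
is excluded; in particular `a` and `d` are positive. -/
structure SplitPlotDesign where
  a : ℕ
  d : ℕ
  n : Fin a → ℕ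
  mean : Fin a → EuclideanSpace ℝ (Fin d)
  cov : Fin a → Matrix (Fin d) (Fin d) ℝ
  cov_posDef : ∀ i, (cov i).PosDef
  TW : Matrix (Fin a) (Fin a) ℝ
  TS : Matrix (Fin d) (Fin d) ℝ
  TW_symm : TW.IsSymm
  TW_idem : IsIdempotentElem TW
  TS_symm : TS.IsSymm
  TS_idem : IsIdempotentElem TS
  T_ne_zero : TW ⊗ₖ TS ≠ 0

namespace SplitPlotDesign

/-- The total sample size `N = ∑ i, n i`. -/
def N (D : SplitPlotDesign) : ℕ := ∑ i, D.n i

/-- The projection matrix `T = TW ⊗ TS`, rows and columns indexed by (group, time). -/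
def T (D : SplitPlotDesign) : Matrix (Fin D.a × Fin D.d) (Fin D.a × Fin D.d) ℝ :=
  D.TW ⊗ₖ D.TS

/-- The vector in `ℝ^(ad)` that stacks `a` vectors of `ℝ^d`. -/
def stack (D : SplitPlotDesign) (v : Fin D.a → EuclideanSpace ℝ (Fin D.d)) :
    Fin D.a × Fin D.d → ℝ :=
  fun p => v p.1 p.2

/-- The null hypothesis `H₀(T) : T μ = 0`. -/
def NullHypothesis (D : SplitPlotDesign) : Prop :=
  D.T *ᵥ D.stack D.mean = 0

/-- The inversely weighted combined covariance matrix `V_N = ⨁ i, (N / n i) Σ i`.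
(`Matrix.blockDiagonal` puts the block index second, whence the swap.) -/
noncomputable def V (D : SplitPlotDesign) :
    Matrix (Fin D.a × Fin D.d) (Fin D.a × Fin D.d) ℝ :=
  (Matrix.blockDiagonal fun i => ((D.N : ℝ) / (D.n i : ℝ)) • D.cov i).submatrix Prod.swap Prod.swap

theorem isHermitian_TVT (D : SplitPlotDesign) : (D.T * D.V * D.T).IsHermitian := by
  have hT : D.Tᴴ = D.T := by
    ext p q
    simp [T, D.TW_symm.apply, D.TS_symm.apply]
  have hV : D.Vᴴ = D.V := by
    rw [V, Matrix.conjTranspose_submatrix, Matrix.blockDiagonal_conjTranspose]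
    congr 2
    funext i
    rw [Matrix.conjTranspose_smul, (D.cov_posDef i).isHermitian.eq]
    simp
  rw [Matrix.IsHermitian, Matrix.conjTranspose_mul, Matrix.conjTranspose_mul, hT, hV,
    Matrix.mul_assoc]

/-- The eigenvalues of `T V_N T`, counted with multiplicity, in decreasing order and indexed from
`0`, so that `D.eigenvalue s` is the usual `λ_{s+1}`; the value is `0` beyond the last of the
`a * d` eigenvalues. -/
noncomputable def eigenvalue (D : SplitPlotDesign) (s : ℕ) : ℝ :=
  if h : s < Fintype.card (Fin D.a × Fin D.d) then D.isHermitian_TVT.eigenvalues₀ ⟨s, h⟩ else 0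

/-- The standardized eigenvalues `β_{s+1} = λ_{s+1} / √(∑ ℓ ≤ ad, λ_ℓ²)`, indexed from `s = 0`. -/
noncomputable def beta (D : SplitPlotDesign) (s : ℕ) : ℝ :=
  D.eigenvalue s / √(∑ l ∈ Finset.range (D.a * D.d), D.eigenvalue l ^ 2)

/-- A data set: the `d`-dimensional observation of the `j`-th unit of group `i`. -/
abbrev Data (D : SplitPlotDesign) : Type :=
  (i : Fin D.a) → Fin (D.n i) → EuclideanSpace ℝ (Fin D.d)

/-- The split-plot model: the `X i j` are independent, and `X i j` is `N(mean i, cov i)`. -/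
structure IsModel (D : SplitPlotDesign) {Ω : Type*} [MeasurableSpace Ω]
    (X : (i : Fin D.a) → Fin (D.n i) → Ω → EuclideanSpace ℝ (Fin D.d)) (P : Measure Ω) : Prop where
  hasLaw : ∀ i j, HasLaw (X i j) (multivariateGaussian (D.mean i) (D.cov i)) P
  indep : iIndepFun (fun p : (i : Fin D.a) × Fin (D.n i) => X p.1 p.2) P

/-- The mean of group `i`. -/
noncomputable def groupMean (D : SplitPlotDesign) (x : D.Data) (i : Fin D.a) :
    EuclideanSpace ℝ (Fin D.d) :=
  (D.n i : ℝ)⁻¹ • ∑ j, x i j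

/-- The quadratic form `Q_N = N * X̄ᵀ T X̄` of the stacked group means. -/
noncomputable def Q (D : SplitPlotDesign) (x : D.Data) : ℝ :=
  (D.N : ℝ) * (D.stack (D.groupMean x) ⬝ᵥ D.T *ᵥ D.stack (D.groupMean x))

/-- The bilinear form `uᵀ TS v`. -/
def bilin (D : SplitPlotDesign) (u v : EuclideanSpace ℝ (Fin D.d)) : ℝ :=
  u.ofLp ⬝ᵥ D.TS *ᵥ v.ofLp

/-- The estimator `A_{i,1}` of `tr (TS Σ i)`. -/
noncomputable def A1 (D : SplitPlotDesign) (x : D.Data) (i : Fin D.a) : ℝ :=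
  1 / (2 * ((D.n i).choose 2 : ℝ)) *
    ∑ l₁ : Fin (D.n i), ∑ l₂ : Fin (D.n i) with l₂ < l₁,
      D.bilin (x i l₁ - x i l₂) (x i l₁ - x i l₂)

/-- The estimator `A_{i,r,2}` of `tr (TS Σ i TS Σ r)`, for `i ≠ r`. -/
noncomputable def A2 (D : SplitPlotDesign) (x : D.Data) (i r : Fin D.a) : ℝ :=
  1 / (4 * ((D.n i).choose 2 : ℝ) * ((D.n r).choose 2 : ℝ)) *
    ∑ l₁ : Fin (D.n i), ∑ l₂ : Fin (D.n i) with l₂ < l₁,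
      ∑ k₁ : Fin (D.n r), ∑ k₂ : Fin (D.n r) with k₂ < k₁,
        D.bilin (x i l₁ - x i l₂) (x r k₁ - x r k₂) ^ 2

/-- The estimator `A_{i,3}` of `tr ((TS Σ i)²)`; the sum runs over `l₂ < l₁` and `k₂ < k₁` with
`l₁, l₂, k₁, k₂` pairwise different. -/
noncomputable def A3 (D : SplitPlotDesign) (x : D.Data) (i : Fin D.a) : ℝ :=
  1 / (4 * 6 * ((D.n i).choose 4 : ℝ)) *
    ∑ l₁ : Fin (D.n i), ∑ l₂ : Fin (D.n i) with l₂ < l₁,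
      ∑ k₂ : Fin (D.n i) with k₂ ≠ l₁ ∧ k₂ ≠ l₂,
        ∑ k₁ : Fin (D.n i) with k₁ ≠ l₁ ∧ k₁ ≠ l₂ ∧ k₂ < k₁,
          D.bilin (x i l₁ - x i l₂) (x i k₁ - x i k₂) ^ 2

/-- The estimator `A_4` of `tr ((T V_N)²)`. -/
noncomputable def A4 (D : SplitPlotDesign) (x : D.Data) : ℝ :=
  ∑ i, ((D.N : ℝ) / D.n i) ^ 2 * D.TW i i ^ 2 * D.A3 x i +
    2 * ∑ i, ∑ r with r < i, (D.N : ℝ) ^ 2 / (D.n i * D.n r) * D.TW i r ^ 2 * D.A2 x i r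

/-- The estimator `∑ i, (N / n i) (TW)_{ii} A_{i,1}` of the null expectation of `Q_N`. -/
noncomputable def meanEst (D : SplitPlotDesign) (x : D.Data) : ℝ :=
  ∑ i, (D.N : ℝ) / D.n i * D.TW i i * D.A1 x i

/-- The estimator `2 A_4` of the null variance of `Q_N`. -/
noncomputable def varEst (D : SplitPlotDesign) (x : D.Data) : ℝ :=
  2 * D.A4 x

/-- The feasible statistic `W_N`. -/
noncomputable def W (D : SplitPlotDesign) (x : D.Data) : ℝ :=
  (D.Q x - D.meanEst x) / √(D.varEst x)

/-- The standardized quadratic form `(Q_N - E Q_N) / √(Var Q_N)`, where `E` and `Var` are taken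
under the distribution of the data. -/
noncomputable def Wtilde (D : SplitPlotDesign) {Ω : Type*} [MeasurableSpace Ω]
    (X : (i : Fin D.a) → Fin (D.n i) → Ω → EuclideanSpace ℝ (Fin D.d)) (P : Measure Ω)
    (ω : Ω) : ℝ :=
  (D.Q (fun i j => X i j ω) - ∫ ω', D.Q (fun i j => X i j ω') ∂P) /
    √(Var[fun ω' => D.Q (fun i j => X i j ω'); P])

end SplitPlotDesign

/-- `min (n₁, …, n_a) → ∞` along a sequence of designs. -/
def MinSampleSizeTendsto (D : ℕ → SplitPlotDesign) : Prop :=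
  ∀ M : ℕ, ∀ᶠ k in atTop, ∀ i, M ≤ (D k).n i

/-- `a` is fixed and `min (d, n₁, …, n_a) → ∞`. -/
def FrameworkFixedGroups (D : ℕ → SplitPlotDesign) : Prop :=
  (∃ a₀, ∀ k, (D k).a = a₀) ∧ Tendsto (fun k => (D k).d) atTop atTop ∧ MinSampleSizeTendsto D

/-- `d` is fixed and `min (a, n₁, …, n_a) → ∞`. -/
def FrameworkFixedDimension (D : ℕ → SplitPlotDesign) : Prop :=
  (∃ d₀, ∀ k, (D k).d = d₀) ∧ Tendsto (fun k => (D k).a) atTop atTop ∧ MinSampleSizeTendsto D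

/-- `min (a, d, n₁, …, n_a) → ∞`. -/
def FrameworkBoth (D : ℕ → SplitPlotDesign) : Prop :=
  Tendsto (fun k => (D k).a) atTop atTop ∧ Tendsto (fun k => (D k).d) atTop atTop ∧
    MinSampleSizeTendsto D

/-- The chi-squared distribution with one degree of freedom: the law of the square of a standard
normal random variable. -/
noncomputable def chiSqOne : Measure ℝ := (gaussianReal 0 1).map (fun z => z ^ 2)

instance isProbabilityMeasure_chiSqOne : IsProbabilityMeasure chiSqOne :=
  Measure.isProbabilityMeasure_map (by fun_prop)

/-!
Let `Z` be the centred and rescaled vector of group means, a Gaussian vector with covariance `V`.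
Under the null hypothesis `Q = Zᵀ T Z`, and diagonalizing `T V T` writes the standardized form as
`W̃ = ∑ s, β s * Y s`, where `Y s = (C s - 1) / √2` are independent standardized chi-squared
variables and `∑ s, β s ^ 2 = 1`. In terms of characteristic functions this is
`SplitPlotDesign.IsModel.charFun_map_Wtilde`, and it reduces the limit of `W̃` to a question about
the weights.

* If `β 0 → 0`, all weights are uniformly negligible, and a second order expansion of the common
  characteristic function of the `Y s` gives the central limit theorem
  `tendsto_prod_charFun_of_negligible`.
* If `β s → b s` for every `s` with `∑ s, b s ^ 2 = 1`, no mass is lost in the limit, so `β → b` in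
  `ℓ²`. Since `∑ s, c s * Y s` has second moment `∑ s, c s ^ 2`, the sums with weights `β`, all
  formed from one sequence `Y`, converge in `L²` and hence in distribution to `∑ s, b s * Y s`
  (`tendstoInMeasure_sum_mul`); that series converges almost surely by martingale convergence
  (`exists_ae_tendsto_sum_mul`). The case `β 0 → 1` is `b = (1, 0, 0, …)`.

To pass from `W̃` to `W`, let `τ = tr ((T V)²) = ∑ i r, (N² / (n i * n r)) (TW i r)² τ i r` with
`τ i r = tr (TS Σ i TS Σ r)`, so that `Q` has mean `tr (T V)` and variance `2 τ`. The summands of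
the estimators `A2` and `A3` use four observations each, so most pairs of summands are independent,
and the variances of `A2` and `A3` are of order `1 / min n` relative to the squares of their
targets `τ i r`, with absolute constants: neither the number of groups nor the dimension enters. As
every term of `τ` is nonnegative, the relative `L¹` error of `A4` is of order `1 / √(min n)`
(`SplitPlotDesign.IsModel.A4_error`). The error of the mean estimator is of the order
`√(τ / min n)`, because different groups are independent and the diagonal terms of `τ` are at most
`τ` in total (`SplitPlotDesign.IsModel.meanEst_moments`). Hence `W - W̃ → 0` in probability as soon
as `min n → ∞`, which all three asymptotic frameworks provide, and Slutsky's argument concludes.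
-/

/-! ### Moments of the normal and of the centred chi-squared distribution -/

theorem integral_pow_four_gaussianReal_zero_one : ∫ x, x ^ 4 ∂gaussianReal 0 1 = 3 := by
  have h0 : (0 : ℝ) ∈ interior (integrableExpSet id (gaussianReal 0 1)) := by
    simp [integrableExpSet_id_gaussianReal]
  -- the moment is the fourth derivative at the origin of the moment generating function
  -- `exp (t ^ 2 / 2)`, whose derivatives are polynomials times `exp (t ^ 2 / 2)`
  have h := iteratedDeriv_mgf_zero h0 4
  have hd : ∀ (p p' : ℝ → ℝ), (∀ t, HasDerivAt p (p' t) t) →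
      deriv (fun t => p t * Real.exp (t ^ 2 / 2)) =
        fun t => (p' t + t * p t) * Real.exp (t ^ 2 / 2) := by
    intro p p' hp
    ext t
    have h1 : HasDerivAt (fun t : ℝ => t ^ 2 / 2) t t := by
      simpa using ((hasDerivAt_id t).pow 2).div_const 2
    rw [HasDerivAt.deriv (by simpa only [Pi.mul_def] using (hp t).mul h1.exp)]
    ring
  have hm : mgf id (gaussianReal 0 1) = fun t => 1 * Real.exp (t ^ 2 / 2) := by
    rw [mgf_id_gaussianReal]; ext t; simp
  have hid : ∀ t : ℝ, HasDerivAt (fun t : ℝ => t) 1 t := fun t => hasDerivAt_id t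
  rw [hm, iteratedDeriv_succ', iteratedDeriv_succ', iteratedDeriv_succ', iteratedDeriv_succ',
    iteratedDeriv_zero, hd (fun _ => 1) (fun _ => 0) (fun t => hasDerivAt_const _ _),
    hd _ (fun _ => 1) (fun t => by simpa using hid t),
    hd _ (fun t => 2 * t) (fun t => by
      convert! ((hid t).pow 2).const_add 1 using 1
      · ext s; simp; ring
      · simp),
    hd _ (fun t => 3 + 3 * t ^ 2) (fun t => by
      convert! ((hid t).const_mul 3).add ((hid t).pow 3) using 1
      · ext s; simp; ring
      · simp; try ring)] at h
  simp at h
  linarith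

theorem hasLaw_fun_id_gaussianReal :
    HasLaw (fun x : ℝ => x) (gaussianReal 0 (1 : ℝ).toNNReal) (gaussianReal 0 1) := by
  rw [Real.toNNReal_one]
  exact HasLaw.id

theorem hasLaw_sqrt_mul_gaussianReal {v : ℝ} (hv : 0 ≤ v) :
    HasLaw (fun x => √v * x) (gaussianReal 0 v.toNNReal) (gaussianReal 0 1) where
  map_eq := by
    rw [gaussianReal_map_const_mul]
    congr 1
    · simp
    · ext; simp [Real.sq_sqrt hv, hv]

section GaussianMoments

variable {Ω : Type*} [MeasurableSpace Ω] {P : Measure Ω} {Y : Ω → ℝ} {v : ℝ}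

theorem memLp_of_hasLaw_gaussianReal {m : ℝ} {w : NNReal} (hY : HasLaw Y (gaussianReal m w) P)
    {p : ENNReal} (hp : p ≠ ⊤) : MemLp Y p P :=
  hY.hasGaussianLaw.memLp hp

theorem integrable_pow_of_hasLaw_gaussianReal {m : ℝ} {w : NNReal}
    (hY : HasLaw Y (gaussianReal m w) P) (n : ℕ) :
    Integrable (fun ω => Y ω ^ n) P := by
  have := hY.isProbabilityMeasure
  have h := memLp_of_hasLaw_gaussianReal hY (p := n) (by simp)
  rcases Nat.eq_zero_or_pos n with rfl | hn
  · simp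
  · have := h.integrable_norm_pow'
    refine (integrable_norm_iff (by have := hY.aemeasurable; fun_prop)).1 ?_
    simpa [norm_pow] using this

theorem integral_sq_of_hasLaw_gaussianReal (hv : 0 ≤ v)
    (hY : HasLaw Y (gaussianReal 0 v.toNNReal) P) : ∫ ω, Y ω ^ 2 ∂P = v := by
  have := hY.isProbabilityMeasure
  have h := hY.variance_eq
  rw [variance_eq_sub (memLp_of_hasLaw_gaussianReal hY (by simp)), hY.integral_eq] at h
  simpa [hv] using h

theorem integral_pow_four_of_hasLaw_gaussianReal (hv : 0 ≤ v)
    (hY : HasLaw Y (gaussianReal 0 v.toNNReal) P) : ∫ ω, Y ω ^ 4 ∂P = 3 * v ^ 2 := by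
  have h1 := hY.integral_comp (f := fun x => x ^ 4) (by fun_prop)
  have h2 := (hasLaw_sqrt_mul_gaussianReal hv).integral_comp (f := fun x => x ^ 4) (by fun_prop)
  simp only [Function.comp_def] at h1 h2
  rw [h1, ← h2]
  simp_rw [mul_pow]
  rw [integral_const_mul, integral_pow_four_gaussianReal_zero_one,
    show √v ^ 4 = (√v ^ 2) ^ 2 by ring, Real.sq_sqrt hv]
  ring

end GaussianMoments

/-- The law of `(C - 1) / √2` for a `χ²₁`-distributed `C`; it has mean zero and variance one. -/
noncomputable def stdChiSq : Measure ℝ := chiSqOne.map (fun c => (c - 1) / √2)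

instance isProbabilityMeasure_stdChiSq : IsProbabilityMeasure stdChiSq :=
  Measure.isProbabilityMeasure_map (by fun_prop)

theorem hasLaw_stdChiSq_of_gaussianReal :
    HasLaw (fun x => (x ^ 2 - 1) / √2) stdChiSq (gaussianReal 0 1) where
  map_eq := by
    rw [stdChiSq, chiSqOne, Measure.map_map (by fun_prop) (by fun_prop)]
    rfl

section StdChiSqMoments

variable {Ω : Type*} [MeasurableSpace Ω] {P : Measure Ω} {Y : Ω → ℝ}

theorem hasLaw_stdChiSq_of_hasLaw_chiSqOne (hY : HasLaw Y chiSqOne P) :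
    HasLaw (fun ω => (Y ω - 1) / √2) stdChiSq P :=
  HasLaw.fun_comp (Y := fun c : ℝ => (c - 1) / √2) ⟨by fun_prop, rfl⟩ hY

theorem memLp_two_stdChiSq : MemLp id 2 stdChiSq := by
  rw [← hasLaw_stdChiSq_of_gaussianReal.map_eq]
  rw [memLp_map_measure_iff (by fun_prop) (by fun_prop)]
  rw [memLp_two_iff_integrable_sq (by fun_prop)]
  have h := fun n => integrable_pow_of_hasLaw_gaussianReal
    (HasLaw.id (μ := gaussianReal 0 1)) n
  have : (fun x : ℝ => (id ∘ fun x : ℝ => (x ^ 2 - 1) / √2) x ^ 2) =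
      fun x => (id x ^ 4 - 2 * id x ^ 2 + 1) / 2 := by
    ext x
    simp only [Function.comp, id, div_pow]
    rw [Real.sq_sqrt (by norm_num)]
    ring
  rw [this]
  exact (((h 4).sub ((h 2).const_mul 2)).add (integrable_const _)).div_const _

theorem memLp_two_of_hasLaw_stdChiSq (hY : HasLaw Y stdChiSq P) : MemLp Y 2 P := by
  have := memLp_two_stdChiSq
  rw [← hY.map_eq, memLp_map_measure_iff (by fun_prop) hY.aemeasurable] at this
  simpa using this

theorem integral_of_hasLaw_stdChiSq (hY : HasLaw Y stdChiSq P) : ∫ ω, Y ω ∂P = 0 := by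
  rw [hY.integral_eq, ← hasLaw_stdChiSq_of_gaussianReal.integral_eq, integral_div, integral_sub,
    integral_sq_of_hasLaw_gaussianReal (v := 1) zero_le_one hasLaw_fun_id_gaussianReal]
  · simp
  · exact integrable_pow_of_hasLaw_gaussianReal (Y := id) HasLaw.id 2
  · simp

theorem integral_sq_of_hasLaw_stdChiSq (hY : HasLaw Y stdChiSq P) : ∫ ω, Y ω ^ 2 ∂P = 1 := by
  have h1 := hY.integral_comp (f := fun x => x ^ 2) (by fun_prop)
  have h2 := hasLaw_stdChiSq_of_gaussianReal.integral_comp (f := fun x => x ^ 2) (by fun_prop)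
  simp only [Function.comp_def] at h1 h2
  have h := fun n => integrable_pow_of_hasLaw_gaussianReal (Y := fun x => x)
    (HasLaw.id (μ := gaussianReal 0 1)) n
  have h3 : (fun x : ℝ => ((x ^ 2 - 1) / √2) ^ 2) =
      fun x => (x ^ 4 - 2 * x ^ 2 + 1) / 2 := by
    ext x
    rw [div_pow, Real.sq_sqrt (by norm_num)]
    ring
  rw [h1, ← h2, h3, integral_div, integral_add (f := fun x : ℝ => x ^ 4 - 2 * x ^ 2)
      ((h 4).sub ((h 2).const_mul 2)) (by simp), integral_sub (h 4) ((h 2).const_mul 2),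
    integral_const_mul,
    integral_pow_four_gaussianReal_zero_one,
    integral_sq_of_hasLaw_gaussianReal (v := 1) zero_le_one hasLaw_fun_id_gaussianReal]
  norm_num

end StdChiSqMoments

/-! ### Central limit theorem for weighted sums with negligible weights -/

theorem norm_prod_sub_prod_le_sum {ι : Type*} (s : Finset ι) (f g : ι → ℂ)
    (hf : ∀ i, ‖f i‖ ≤ 1) (hg : ∀ i, ‖g i‖ ≤ 1) :
    ‖∏ i ∈ s, f i - ∏ i ∈ s, g i‖ ≤ ∑ i ∈ s, ‖f i - g i‖ := by
  classical
  induction s using Finset.induction with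
  | empty => simp
  | insert a s ha ih =>
    rw [Finset.prod_insert ha, Finset.prod_insert ha, Finset.sum_insert ha]
    have h1 : ‖∏ i ∈ s, g i‖ ≤ 1 := by
      rw [norm_prod]
      exact Finset.prod_le_one (fun _ _ => norm_nonneg _) fun i _ => hg i
    calc ‖f a * ∏ i ∈ s, f i - g a * ∏ i ∈ s, g i‖
        = ‖f a * (∏ i ∈ s, f i - ∏ i ∈ s, g i) + (f a - g a) * ∏ i ∈ s, g i‖ := by
          congr 1; ring
      _ ≤ ‖f a‖ * ‖∏ i ∈ s, f i - ∏ i ∈ s, g i‖ + ‖f a - g a‖ * ‖∏ i ∈ s, g i‖ := by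
          rw [← norm_mul, ← norm_mul]; exact norm_add_le _ _
      _ ≤ 1 * ‖∏ i ∈ s, f i - ∏ i ∈ s, g i‖ + ‖f a - g a‖ * 1 := by
          gcongr
          exact hf a
      _ ≤ _ := by linarith

/-- The characteristic functions of `ν` and of the standard normal law agree up to `o(u²)` at the
origin, so the errors of the factors add up to `o(1) ∑ β_s² = o(1)` if the weights are uniformly
small. -/
theorem tendsto_prod_charFun_of_negligible {ν : Measure ℝ} [IsProbabilityMeasure ν]
    (h0 : ∫ x, x ∂ν = 0) (h1 : ∫ x, x ^ 2 ∂ν = 1) (m : ℕ → ℕ) (β : ℕ → ℕ → ℝ) (δ : ℕ → ℝ)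
    (hβ : ∀ᶠ k in atTop, ∑ s ∈ Finset.range (m k), β k s ^ 2 = 1)
    (hδ : Tendsto δ atTop (𝓝 0)) (hβδ : ∀ k s, |β k s| ≤ δ k) (t : ℝ) :
    Tendsto (fun k => ∏ s ∈ Finset.range (m k), charFun ν (β k s * t)) atTop
      (𝓝 (charFun (gaussianReal 0 1) t)) := by
  have ho : (fun u => charFun ν u - charFun (gaussianReal 0 1) u) =o[𝓝 0] fun u => u ^ 2 := by
    have e1 := taylor_charFun_two (P := ν) (X := fun x => x) (by fun_prop) h0 (by simpa using h1)
    have e2 := taylor_charFun_two (P := gaussianReal 0 1) (X := fun x => x) (by fun_prop)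
      (by simp) (by
        simpa using integral_sq_of_hasLaw_gaussianReal zero_le_one hasLaw_fun_id_gaussianReal)
    simp only [Measure.map_id'] at e1 e2
    refine (e1.sub e2).congr_left fun u => ?_
    ring
  -- the normal characteristic function splits into factors along the unit vector `β k`
  have hsplit : ∀ᶠ k in atTop, charFun (gaussianReal 0 1) t =
      ∏ s ∈ Finset.range (m k), charFun (gaussianReal 0 1) (β k s * t) := by
    filter_upwards [hβ] with k hk
    simp only [charFun_gaussianReal]
    rw [← Complex.exp_sum]
    congr 1
    have : ((∑ s ∈ Finset.range (m k), β k s ^ 2 : ℝ) : ℂ) = 1 := by rw [hk]; simp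
    push_cast at this
    simp only [Complex.ofReal_zero, mul_zero, zero_mul, NNReal.coe_one, Complex.ofReal_one,
      zero_sub, Complex.ofReal_mul, mul_pow]
    rw [Finset.sum_neg_distrib, ← Finset.sum_div, ← Finset.mul_sum, ← Finset.sum_mul, this]
    ring
  rw [tendsto_iff_norm_sub_tendsto_zero]
  refine Metric.tendsto_atTop'.2 fun ε hε => ?_
  have hc : 0 < ε / (t ^ 2 + 1) := by positivity
  obtain ⟨r, hr, hr'⟩ := Metric.eventually_nhds_iff.1 (ho.def hc)
  have hδt : ∀ᶠ k in atTop, δ k * |t| < r := by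
    have := hδ.mul_const |t|
    rw [zero_mul] at this
    exact this.eventually_lt_const hr
  obtain ⟨K, hK⟩ := eventually_atTop.1 (hsplit.and (hβ.and hδt))
  refine ⟨K, fun k hk => ?_⟩
  obtain ⟨hs, hb, hd⟩ := hK k hk.le
  rw [Real.dist_eq, sub_zero, abs_norm, hs]
  calc _ ≤ ∑ s ∈ Finset.range (m k),
        ‖charFun ν (β k s * t) - charFun (gaussianReal 0 1) (β k s * t)‖ :=
        norm_prod_sub_prod_le_sum _ _ _ (fun _ => norm_charFun_le_one _)
          (fun _ => norm_charFun_le_one _)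
    _ ≤ ∑ s ∈ Finset.range (m k), ε / (t ^ 2 + 1) * (β k s ^ 2 * t ^ 2) := by
        refine Finset.sum_le_sum fun s _ => ?_
        have := hr' (y := β k s * t) (by
          rw [Real.dist_eq, sub_zero, abs_mul]
          exact (mul_le_mul_of_nonneg_right (hβδ k s) (abs_nonneg t)).trans_lt hd)
        simpa [mul_pow] using this
    _ = ε * (t ^ 2 / (t ^ 2 + 1)) := by
        rw [← Finset.mul_sum, ← Finset.sum_mul, hb]; ring
    _ < ε * 1 := by
        gcongr
        rw [div_lt_one (by positivity)]
        linarith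
    _ = ε := mul_one ε

/-! ### Convergence in distribution along changing probability spaces -/

section Distribution

variable {Ω : ℕ → Type*} [∀ k, MeasurableSpace (Ω k)] {P : (k : ℕ) → Measure (Ω k)}
  [∀ k, IsProbabilityMeasure (P k)] {Ω' : Type*} [MeasurableSpace Ω'] {P' : Measure Ω'}
  [IsProbabilityMeasure P'] {X Y : (k : ℕ) → Ω k → ℝ} {Z : Ω' → ℝ}

theorem tendstoInDistribution_iff_tendsto_charFun (hX : ∀ k, AEMeasurable (X k) (P k))
    (hZ : AEMeasurable Z P') :
    TendstoInDistribution X atTop Z P P' ↔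
      ∀ t, Tendsto (fun k => charFun ((P k).map (X k)) t) atTop (𝓝 (charFun (P'.map Z) t)) :=
  ⟨fun h => ProbabilityMeasure.tendsto_iff_tendsto_charFun.1 h.tendsto,
    fun h => ⟨hX, hZ, ProbabilityMeasure.tendsto_iff_tendsto_charFun.2 h⟩⟩

theorem norm_exp_ofReal_mul_I_sub_exp_ofReal_mul_I_le (x y : ℝ) :
    ‖Complex.exp (x * Complex.I) - Complex.exp (y * Complex.I)‖ ≤ |x - y| := by
  have h : Complex.exp (x * Complex.I) - Complex.exp (y * Complex.I) =
      Complex.exp (y * Complex.I) * (Complex.exp (Complex.I * ((x - y : ℝ) : ℂ)) - 1) := by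
    rw [mul_sub, ← Complex.exp_add, mul_one]
    congr 2
    push_cast
    ring
  rw [h, norm_mul, Complex.norm_exp_ofReal_mul_I, one_mul]
  exact Real.norm_exp_I_mul_ofReal_sub_one_le

/-- Off the event `|Y - X| ≥ ε` the characters at `t` differ by at most `|t| ε`, and everywhere by
at most `2`. -/
theorem norm_charFun_map_sub_charFun_map_le {Ω : Type*} [MeasurableSpace Ω] {P : Measure Ω}
    [IsProbabilityMeasure P] {X Y : Ω → ℝ} (hX : AEMeasurable X P) (hY : AEMeasurable Y P)
    (t : ℝ) {ε : ℝ} (hε : 0 ≤ ε) :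
    ‖charFun (P.map Y) t - charFun (P.map X) t‖ ≤
      |t| * ε + 2 * P.real {ω | ε ≤ |Y ω - X ω|} := by
  have hm : ∀ {Z : Ω → ℝ}, AEMeasurable Z P →
      AEStronglyMeasurable (fun ω => Complex.exp (t * Z ω * Complex.I)) P := by
    intro Z hZ
    exact (by fun_prop : AEMeasurable _ P).aestronglyMeasurable
  have hi : ∀ {Z : Ω → ℝ}, AEMeasurable Z P →
      Integrable (fun ω => Complex.exp (t * Z ω * Complex.I)) P := by
    intro Z hZ
    refine Integrable.of_bound (hm hZ) 1 (ae_of_all _ fun ω => ?_)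
    rw [← Complex.ofReal_mul, Complex.norm_exp_ofReal_mul_I]
  have hA : NullMeasurableSet {ω | ε ≤ |Y ω - X ω|} P :=
    nullMeasurableSet_le aemeasurable_const (by fun_prop)
  rw [charFun_apply_real, charFun_apply_real, integral_map hY (by fun_prop),
    integral_map hX (by fun_prop), ← integral_sub (hi hY) (hi hX)]
  have hind : Integrable ({ω | ε ≤ |Y ω - X ω|}.indicator fun _ => (2 : ℝ)) P :=
    (integrable_const _).indicator₀ hA
  calc _ ≤ ∫ ω, (|t| * ε + {ω | ε ≤ |Y ω - X ω|}.indicator (fun _ => (2 : ℝ)) ω) ∂P := by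
        refine norm_integral_le_of_norm_le ((integrable_const _).add hind) (ae_of_all _ fun ω => ?_)
        by_cases hω : ε ≤ |Y ω - X ω|
        · rw [Set.indicator_of_mem (by exact hω)]
          refine (norm_sub_le _ _).trans ?_
          rw [← Complex.ofReal_mul, Complex.norm_exp_ofReal_mul_I, ← Complex.ofReal_mul,
            Complex.norm_exp_ofReal_mul_I]
          have := mul_nonneg (abs_nonneg t) hε
          linarith
        · rw [Set.indicator_of_notMem (by exact hω), add_zero, ← Complex.ofReal_mul,
            ← Complex.ofReal_mul]
          refine (norm_exp_ofReal_mul_I_sub_exp_ofReal_mul_I_le _ _).trans ?_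
          rw [← mul_sub, abs_mul]
          exact mul_le_mul_of_nonneg_left (not_le.1 hω).le (abs_nonneg t)
    _ = _ := by
        rw [integral_add (integrable_const _) hind, integral_indicator₀ hA]
        simp [mul_comm]

/-- The additive part of Slutsky's theorem, for random variables on changing spaces. -/
theorem TendstoInDistribution.of_sub_tendsto_zero (h : TendstoInDistribution X atTop Z P P')
    (hY : ∀ k, AEMeasurable (Y k) (P k))
    (hXY : ∀ ε > 0, Tendsto (fun k => (P k).real {ω | ε ≤ |Y k ω - X k ω|}) atTop (𝓝 0)) :
    TendstoInDistribution Y atTop Z P P' := by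
  have hX := h.forall_aemeasurable
  have hZ := h.aemeasurable_limit
  rw [tendstoInDistribution_iff_tendsto_charFun hX hZ] at h
  rw [tendstoInDistribution_iff_tendsto_charFun hY hZ]
  intro t
  have h0 : Tendsto (fun k => charFun ((P k).map (Y k)) t - charFun ((P k).map (X k)) t) atTop
      (𝓝 0) := by
    refine Metric.tendsto_atTop'.2 fun ε hε => ?_
    have hε' : 0 < ε / (2 * (|t| + 1)) := by positivity
    have := (hXY _ hε').eventually_lt_const (show 0 < ε / 4 by positivity)
    obtain ⟨K, hK⟩ := eventually_atTop.1 this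
    refine ⟨K, fun k hk => ?_⟩
    rw [dist_zero_right]
    refine (norm_charFun_map_sub_charFun_map_le (hX k) (hY k) t hε'.le).trans_lt ?_
    have h1 := hK k hk.le
    have h2 : |t| * (ε / (2 * (|t| + 1))) ≤ ε / 2 := by
      rw [mul_div_assoc', div_le_iff₀ (by positivity)]
      nlinarith [abs_nonneg t]
    linarith
  simpa using h0.add (h t)

end Distribution

/-! ### Weighted sums of independent standardized random variables -/

section WeightedSum

variable {Ω : Type*} [MeasurableSpace Ω] {P : Measure Ω} {Y : ℕ → Ω → ℝ}

theorem charFun_map_sum_mul_eq_prod {ν : Measure ℝ} (hY : iIndepFun Y P)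
    (hν : ∀ s, HasLaw (Y s) ν P) (c : ℕ → ℝ) (A : Finset ℕ) (t : ℝ) :
    charFun (P.map fun ω => ∑ s ∈ A, c s * Y s ω) t = ∏ s ∈ A, charFun ν (c s * t) := by
  have hc : iIndepFun (fun s ω => c s * Y s ω) P :=
    hY.comp (fun s x => c s * x) (fun s => by fun_prop)
  rw [(hc.restrict _).charFun_map_fun_finsetSum_eq_prod (s := A)
    (fun s _ => (hν s).aemeasurable.const_mul _), Finset.prod_apply]
  refine Finset.prod_congr rfl fun s _ => ?_
  rw [charFun_map_mul_comp (hν s).aemeasurable, (hν s).map_eq]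

variable [IsProbabilityMeasure P]

theorem integral_sum_mul_eq_zero (hL : ∀ s, MemLp (Y s) 2 P) (h0 : ∀ s, ∫ ω, Y s ω ∂P = 0)
    (c : ℕ → ℝ) (A : Finset ℕ) : ∫ ω, ∑ s ∈ A, c s * Y s ω ∂P = 0 := by
  rw [integral_finsetSum _ fun s _ => ((hL s).integrable (by norm_num)).const_mul _]
  simp [integral_const_mul, h0]

theorem integral_sq_sum_mul_eq (hY : iIndepFun Y P) (hL : ∀ s, MemLp (Y s) 2 P)
    (h0 : ∀ s, ∫ ω, Y s ω ∂P = 0) (h1 : ∀ s, ∫ ω, Y s ω ^ 2 ∂P = 1) (c : ℕ → ℝ) (A : Finset ℕ) :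
    ∫ ω, (∑ s ∈ A, c s * Y s ω) ^ 2 ∂P = ∑ s ∈ A, c s ^ 2 := by
  have hm : ∀ s, MemLp (fun ω => c s * Y s ω) 2 P := fun s => (hL s).const_mul _
  have hv := IndepFun.variance_sum (μ := P) (s := A) (X := fun s ω => c s * Y s ω)
    (fun s _ => hm s) (fun s _ r _ hsr =>
      (hY.indepFun hsr).comp (φ := fun x => c s * x) (ψ := fun x => c r * x)
        (by fun_prop) (by fun_prop))
  have he := integral_sum_mul_eq_zero hL h0 c A
  have hs : (∑ s ∈ A, fun ω => c s * Y s ω) = fun ω => ∑ s ∈ A, c s * Y s ω := by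
    ext ω; simp
  rw [hs, variance_of_integral_eq_zero (memLp_finsetSum A fun s _ => hm s).aemeasurable he] at hv
  rw [hv]
  refine Finset.sum_congr rfl fun s _ => ?_
  rw [variance_const_mul, variance_of_integral_eq_zero (hL s).aemeasurable (h0 s), h1 s, mul_one]

/-- The partial sums form an `L²`-bounded martingale, which converges almost surely. -/
theorem exists_ae_tendsto_sum_mul (hY : iIndepFun Y P) (hL : ∀ s, MemLp (Y s) 2 P)
    (h0 : ∀ s, ∫ ω, Y s ω ∂P = 0) (h1 : ∀ s, ∫ ω, Y s ω ^ 2 ∂P = 1) {b : ℕ → ℝ}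
    (hb : Summable fun s => b s ^ 2) :
    ∃ L : Ω → ℝ, AEMeasurable L P ∧
      ∀ᵐ ω ∂P, Tendsto (fun m => ∑ s ∈ Finset.range m, b s * Y s ω) atTop (𝓝 (L ω)) := by
  -- the natural filtration needs genuinely measurable variables
  let Z : ℕ → Ω → ℝ := fun s => (hL s).aemeasurable.mk (Y s)
  have hZm : ∀ s, StronglyMeasurable (Z s) := fun s =>
    (hL s).aemeasurable.measurable_mk.stronglyMeasurable
  have hYZ : ∀ s, Y s =ᵐ[P] Z s := fun s => (hL s).aemeasurable.ae_eq_mk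
  have hZ : iIndepFun Z P := hY.congr hYZ
  have hZL : ∀ s, MemLp (Z s) 2 P := fun s => (memLp_congr_ae (hYZ s)).1 (hL s)
  have hZ0 : ∀ s, ∫ ω, Z s ω ∂P = 0 := fun s => by rw [← integral_congr_ae (hYZ s), h0]
  have hZ1 : ∀ s, ∫ ω, Z s ω ^ 2 ∂P = 1 := fun s => by
    rw [← h1 s]
    refine integral_congr_ae ?_
    filter_upwards [hYZ s] with ω h
    rw [h]
  let M : ℕ → Ω → ℝ := fun n ω => ∑ s ∈ Finset.range (n + 1), b s * Z s ω
  have hMi : ∀ n, MemLp (M n) 2 P := fun n => memLp_finsetSum _ fun s _ => (hZL s).const_mul _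
  have hMad : StronglyAdapted (Filtration.natural Z hZm) M := by
    intro n
    refine Finset.stronglyMeasurable_fun_sum _ fun s hs => ?_
    refine StronglyMeasurable.const_mul ?_ _
    exact (Filtration.stronglyAdapted_natural hZm s).mono
      ((Filtration.natural Z hZm).mono (Nat.lt_succ_iff.1 (Finset.mem_range.1 hs)))
  have hMart : Martingale M (Filtration.natural Z hZm) P := by
    refine martingale_nat hMad (fun n => (hMi n).integrable (by norm_num)) fun n => ?_
    have hs : M (n + 1) = M n + fun ω => b (n + 1) * Z (n + 1) ω := by
      ext ω; simp [M, Finset.sum_range_succ]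
    have hi := (hZL (n + 1)).integrable (by norm_num)
    rw [hs]
    have e1 := condExp_add (m := Filtration.natural Z hZm n)
      ((hMi n).integrable (by norm_num)) (hi.const_mul (b (n + 1)))
    have e2 : P[M n | Filtration.natural Z hZm n] = M n :=
      condExp_of_stronglyMeasurable _ (hMad n) ((hMi n).integrable (by norm_num))
    have e3 := condExp_smul (m := Filtration.natural Z hZm n) (μ := P) (b (n + 1)) (Z (n + 1))
    have e4 := hZ.condExp_natural_ae_eq_of_lt hZm (Nat.lt_succ_self n)
    filter_upwards [e1, e3, e4] with ω i1 i3 i4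
    rw [i1, Pi.add_apply, e2]
    have : (fun ω => b (n + 1) * Z (n + 1) ω) = b (n + 1) • Z (n + 1) := rfl
    rw [this, i3, Pi.smul_apply, i4, hZ0]
    simp
  have hbdd : ∀ n, eLpNorm (M n) 1 P ≤ (Real.toNNReal ((1 + ∑' s, b s ^ 2) / 2) : ENNReal) := by
    intro n
    have hi := (hMi n).integrable (by norm_num)
    rw [eLpNorm_one_eq_lintegral_enorm, ← ofReal_integral_norm_eq_lintegral_enorm hi]
    refine ENNReal.ofReal_le_ofReal ?_
    have h2 : Integrable (fun ω => M n ω ^ 2) P := (hMi n).integrable_sq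
    calc ∫ ω, ‖M n ω‖ ∂P ≤ ∫ ω, (1 + M n ω ^ 2) / 2 ∂P := by
          refine integral_mono hi.norm (((integrable_const _).add h2).div_const _) fun ω => ?_
          have := sq_nonneg (|M n ω| - 1)
          rw [sub_sq, sq_abs] at this
          simp only [Real.norm_eq_abs]
          linarith
      _ = (1 + ∑ s ∈ Finset.range (n + 1), b s ^ 2) / 2 := by
          rw [integral_div, integral_add (integrable_const _) h2,
            integral_sq_sum_mul_eq hZ hZL hZ0 hZ1]
          simp
      _ ≤ _ := by
          gcongr
          exact hb.sum_le_tsum _ fun _ _ => sq_nonneg _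
  refine ⟨Filtration.limitProcess M (Filtration.natural Z hZm) P,
    Filtration.stronglyMeasurable_limit_process'.measurable.aemeasurable, ?_⟩
  filter_upwards [hMart.submartingale.ae_tendsto_limitProcess hbdd, ae_all_iff.2 hYZ] with ω h h'
  refine (tendsto_add_atTop_iff_nat 1).1 ?_
  simpa only [h'] using h

/-- Pointwise convergence of unit vectors of `ℓ²` to a unit vector is convergence in norm. -/
theorem eventually_sum_sq_sub_le {m : ℕ → ℕ} {β : ℕ → ℕ → ℝ} {b : ℕ → ℝ}
    (hβ : ∀ᶠ k in atTop, ∑ s ∈ Finset.range (m k), β k s ^ 2 = 1)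
    (hβ0 : ∀ k s, m k ≤ s → β k s = 0) (hb : HasSum (fun s => b s ^ 2) 1)
    (hβb : ∀ s, Tendsto (fun k => β k s) atTop (𝓝 (b s))) {ε : ℝ} (hε : 0 < ε) :
    ∀ᶠ k in atTop, ∀ n, ∑ s ∈ Finset.range n, (β k s - b s) ^ 2 ≤ ε := by
  have hε5 : 0 < ε / 5 := by positivity
  have hle : ∀ n, ∑ s ∈ Finset.range n, b s ^ 2 ≤ 1 := fun n =>
    sum_le_hasSum _ (fun _ _ => sq_nonneg _) hb
  obtain ⟨M, hM⟩ := (hb.tendsto_sum_nat.eventually_const_lt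
    (show 1 - ε / 5 < 1 by linarith)).exists
  have t1 : Tendsto (fun k => ∑ s ∈ Finset.range M, (β k s - b s) ^ 2) atTop (𝓝 0) := by
    have := tendsto_finsetSum (Finset.range M) fun s _ => ((hβb s).sub_const (b s)).pow 2
    simpa using this
  have t2 : Tendsto (fun k => ∑ s ∈ Finset.range M, β k s ^ 2) atTop
      (𝓝 (∑ s ∈ Finset.range M, b s ^ 2)) :=
    tendsto_finsetSum (Finset.range M) fun s _ => (hβb s).pow 2
  filter_upwards [hβ, t1.eventually_lt_const hε5, t2.eventually_const_lt hM] with k h1 h2 h3 n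
  have hleβ : ∀ n, ∑ s ∈ Finset.range n, β k s ^ 2 ≤ 1 := by
    intro n
    rw [← h1, Finset.sum_subset (Finset.range_mono (le_max_left (m k) n))]
    · exact Finset.sum_le_sum_of_subset_of_nonneg (Finset.range_mono (le_max_right _ _))
        fun _ _ _ => sq_nonneg _
    · intro s _ hs
      rw [hβ0 k s (by simpa using hs)]
      ring
  have hn := le_max_right n M
  have split := fun f : ℕ → ℝ => Finset.sum_range_add_sum_Ico f hn
  have hs := split fun s => (β k s - b s) ^ 2
  have hsβ := split fun s => β k s ^ 2
  have hsb := split fun s => b s ^ 2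
  have hI : ∑ s ∈ Finset.Ico M (max n M), (β k s - b s) ^ 2 ≤
      2 * ∑ s ∈ Finset.Ico M (max n M), β k s ^ 2 + 2 * ∑ s ∈ Finset.Ico M (max n M), b s ^ 2 := by
    rw [Finset.mul_sum, Finset.mul_sum, ← Finset.sum_add_distrib]
    refine Finset.sum_le_sum fun s _ => ?_
    nlinarith [sq_nonneg (β k s + b s)]
  have h4 := hleβ (max n M)
  have h5 := hle (max n M)
  calc ∑ s ∈ Finset.range n, (β k s - b s) ^ 2
      ≤ ∑ s ∈ Finset.range (max n M), (β k s - b s) ^ 2 :=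
        Finset.sum_le_sum_of_subset_of_nonneg (Finset.range_mono (le_max_left _ _))
          fun _ _ _ => sq_nonneg _
    _ ≤ ε := by linarith

/-- The weighted sums converge to the series with the limiting weights in `L²`, by Fatou's lemma
along the partial sums of the series. -/
theorem tendstoInMeasure_sum_mul (hY : iIndepFun Y P) (hL : ∀ s, MemLp (Y s) 2 P)
    (h0 : ∀ s, ∫ ω, Y s ω ∂P = 0) (h1 : ∀ s, ∫ ω, Y s ω ^ 2 ∂P = 1) {m : ℕ → ℕ} {β : ℕ → ℕ → ℝ}
    {b : ℕ → ℝ} (hβ : ∀ᶠ k in atTop, ∑ s ∈ Finset.range (m k), β k s ^ 2 = 1)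
    (hβ0 : ∀ k s, m k ≤ s → β k s = 0) (hb : HasSum (fun s => b s ^ 2) 1)
    (hβb : ∀ s, Tendsto (fun k => β k s) atTop (𝓝 (b s))) {L : Ω → ℝ} (hLm : AEMeasurable L P)
    (hlim : ∀ᵐ ω ∂P, Tendsto (fun m => ∑ s ∈ Finset.range m, b s * Y s ω) atTop (𝓝 (L ω))) :
    TendstoInMeasure P (fun k ω => ∑ s ∈ Finset.range (m k), β k s * Y s ω) atTop L := by
  have hYm := fun s => (hL s).aemeasurable
  have hSm : ∀ (c : ℕ → ℝ) n, AEMeasurable (fun ω => ∑ s ∈ Finset.range n, c s * Y s ω) P :=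
    fun c n => Finset.aemeasurable_fun_sum _ fun s _ => (hYm s).const_mul _
  refine tendstoInMeasure_of_tendsto_eLpNorm (p := 2) (by norm_num)
    (fun k => (hSm _ _).aestronglyMeasurable) hLm.aestronglyMeasurable ?_
  refine ENNReal.tendsto_nhds_zero.2 fun δ hδ => ?_
  rcases eq_or_ne δ ⊤ with rfl | hδt
  · simp
  have hε : 0 < δ.toReal ^ 2 := by
    have := ENNReal.toReal_pos hδ.ne' hδt
    positivity
  filter_upwards [eventually_sum_sq_sub_le hβ hβ0 hb hβb hε] with k hk
  have hfat : ∫⁻ ω, ‖∑ s ∈ Finset.range (m k), β k s * Y s ω - L ω‖ₑ ^ 2 ∂P ≤ δ ^ 2 := by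
    calc _ ≤ ∫⁻ ω, liminf (fun n =>
            ‖∑ s ∈ Finset.range n, (β k s - b s) * Y s ω‖ₑ ^ 2) atTop ∂P := by
          refine lintegral_mono_ae ?_
          filter_upwards [hlim] with ω hω
          refine le_of_eq (Tendsto.liminf_eq ?_).symm
          have : Tendsto (fun n => ∑ s ∈ Finset.range n, (β k s - b s) * Y s ω) atTop
              (𝓝 (∑ s ∈ Finset.range (m k), β k s * Y s ω - L ω)) := by
            simp only [sub_mul, Finset.sum_sub_distrib]
            refine Tendsto.sub ?_ hω
            refine tendsto_const_nhds.congr' ?_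
            filter_upwards [eventually_ge_atTop (m k)] with n hn
            refine Finset.sum_subset (Finset.range_mono hn) fun s _ hs => ?_
            rw [hβ0 k s (by simpa using hs), zero_mul]
          exact (ENNReal.continuous_pow 2).continuousAt.tendsto.comp
            (continuous_enorm.continuousAt.tendsto.comp this)
      _ ≤ liminf (fun n => ∫⁻ ω, ‖∑ s ∈ Finset.range n, (β k s - b s) * Y s ω‖ₑ ^ 2 ∂P) atTop :=
          lintegral_liminf_le' fun n => (hSm _ n).enorm.pow_const 2
      _ ≤ δ ^ 2 := by
          refine liminf_le_of_le (by isBoundedDefault) fun x hx => ?_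
          obtain ⟨n, hn⟩ := hx.exists
          refine hn.trans ?_
          have hi : Integrable (fun ω => (∑ s ∈ Finset.range n, (β k s - b s) * Y s ω) ^ 2) P :=
            (memLp_finsetSum (Finset.range n)
              fun s _ => (hL s).const_mul (β k s - b s)).integrable_sq
          have h2 : ∀ ω, ‖∑ s ∈ Finset.range n, (β k s - b s) * Y s ω‖ₑ ^ 2 =
              ENNReal.ofReal ((∑ s ∈ Finset.range n, (β k s - b s) * Y s ω) ^ 2) := fun ω => by
            rw [Real.enorm_eq_ofReal_abs, ← ENNReal.ofReal_pow (abs_nonneg _), sq_abs]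
          simp_rw [h2]
          rw [← ofReal_integral_eq_lintegral_ofReal hi (ae_of_all _ fun _ => sq_nonneg _),
            integral_sq_sum_mul_eq hY hL h0 h1 (fun s => β k s - b s),
            ← ENNReal.ofReal_toReal hδt, ← ENNReal.ofReal_pow ENNReal.toReal_nonneg]
          exact ENNReal.ofReal_le_ofReal (hk n)
  rw [eLpNorm_eq_lintegral_rpow_enorm_toReal (by norm_num) (by norm_num)]
  simp only [ENNReal.toReal_ofNat, ENNReal.rpow_ofNat, Pi.sub_apply]
  calc _ ≤ (δ ^ 2) ^ (1 / 2 : ℝ) := ENNReal.rpow_le_rpow hfat (by norm_num)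
    _ = δ := by
        rw [← ENNReal.rpow_natCast, ← ENNReal.rpow_mul]
        norm_num

end WeightedSum

/-! ### Bilinear forms in independent normal vectors -/

/-- `Z` is a centred normal vector with covariance matrix `S`. -/
structure IsCenteredGaussian {ι Ω : Type*} [Fintype ι] [MeasurableSpace Ω] (Z : Ω → ι → ℝ)
    (S : Matrix ι ι ℝ) (P : Measure Ω) : Prop where
  gaussian : HasGaussianLaw Z P
  mean : ∀ i, ∫ ω, Z ω i ∂P = 0
  cov : ∀ i j, cov[fun ω => Z ω i, fun ω => Z ω j; P] = S i j

namespace IsCenteredGaussian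

variable {ι Ω : Type*} [Fintype ι] [MeasurableSpace Ω] {Z : Ω → ι → ℝ} {S : Matrix ι ι ℝ}
  {P : Measure Ω}

theorem memLp (hZ : IsCenteredGaussian Z S P) (i : ι) {p : ENNReal} (hp : p ≠ ⊤) :
    MemLp (fun ω => Z ω i) p P :=
  (hZ.gaussian.eval i).memLp hp

theorem cov_dotProduct (hZ : IsCenteredGaussian Z S P) (c c' : ι → ℝ) :
    cov[fun ω => c ⬝ᵥ Z ω, fun ω => c' ⬝ᵥ Z ω; P] = c ⬝ᵥ S *ᵥ c' := by
  have := hZ.gaussian.isProbabilityMeasure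
  have h : ∀ (c : ι → ℝ) i, MemLp (fun ω => c i * Z ω i) 2 P := fun c i =>
    (hZ.memLp i (by norm_num)).const_mul _
  simp only [dotProduct]
  rw [covariance_fun_sum_fun_sum (h c) (h c')]
  simp only [covariance_const_mul_left, covariance_const_mul_right, hZ.cov, Matrix.mulVec,
    dotProduct, Finset.mul_sum]
  refine Finset.sum_congr rfl fun i _ => Finset.sum_congr rfl fun j _ => ?_
  ring

theorem hasLaw_dotProduct (hZ : IsCenteredGaussian Z S P) (c : ι → ℝ) :
    HasLaw (fun ω => c ⬝ᵥ Z ω) (gaussianReal 0 (c ⬝ᵥ S *ᵥ c).toNNReal) P := by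
  have := hZ.gaussian.isProbabilityMeasure
  have hg : HasGaussianLaw (fun ω => c ⬝ᵥ Z ω) P := by
    have := hZ.gaussian.map_fun (∑ i, c i • ContinuousLinearMap.proj (R := ℝ) (φ := fun _ => ℝ) i)
    simpa [dotProduct] using this
  refine ⟨hg.aemeasurable, ?_⟩
  rw [hg.map_eq_gaussianReal, ← covariance_self hg.aemeasurable, hZ.cov_dotProduct]
  congr 1
  simp only [dotProduct]
  rw [integral_finsetSum _ fun i _ => ((hZ.memLp i (by norm_num)).integrable le_rfl).const_mul _]
  simp [integral_const_mul, hZ.mean]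

theorem posSemidef (hZ : IsCenteredGaussian Z S P) : S.PosSemidef := by
  refine Matrix.PosSemidef.of_dotProduct_mulVec_nonneg ?_ fun c => ?_
  · ext i j
    rw [Matrix.conjTranspose_apply, star_trivial, ← hZ.cov, ← hZ.cov, covariance_comm]
  · rw [star_trivial, ← hZ.cov_dotProduct, covariance_self (hZ.hasLaw_dotProduct c).aemeasurable]
    exact variance_nonneg _ _

end IsCenteredGaussian

section SumSq

variable {κ Ω : Type*} [MeasurableSpace Ω] {P : Measure Ω} {Y : κ → Ω → ℝ} {v : κ → ℝ}

theorem integral_sum_sq_of_gaussianReal (s : Finset κ) (hv : ∀ p, 0 ≤ v p)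
    (hY : ∀ p, HasLaw (Y p) (gaussianReal 0 (v p).toNNReal) P) :
    ∫ ω, ∑ p ∈ s, Y p ω ^ 2 ∂P = ∑ p ∈ s, v p := by
  rw [integral_finsetSum _ fun p _ => integrable_pow_of_hasLaw_gaussianReal (hY p) 2]
  exact Finset.sum_congr rfl fun p _ => integral_sq_of_hasLaw_gaussianReal (hv p) (hY p)

/-- The second moment of a sum of squares of normal variables, whatever their dependence, is at
most three times the square of its mean: Cauchy–Schwarz with weights `v p` reduces it to fourth
moments. -/
theorem integral_sq_sum_sq_le (s : Finset κ) (hv : ∀ p, 0 ≤ v p)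
    (hY : ∀ p, HasLaw (Y p) (gaussianReal 0 (v p).toNNReal) P) :
    ∫ ω, (∑ p ∈ s, Y p ω ^ 2) ^ 2 ∂P ≤ 3 * (∑ p ∈ s, v p) ^ 2 := by
  have hi : ∀ p, Integrable (fun ω => Y p ω ^ 4 / v p) P := fun p =>
    (integrable_pow_of_hasLaw_gaussianReal (hY p) 4).div_const _
  have h0 : ∀ p ∈ s, ∀ᵐ ω ∂P, v p = 0 → Y p ω = 0 := by
    intro p _
    by_cases h : v p = 0
    · have h1 := hY p
      rw [h, Real.toNNReal_zero, gaussianReal_zero_var] at h1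
      filter_upwards [h1.ae_eq_of_dirac] with ω hω _
      exact hω
    · exact ae_of_all _ fun ω h' => absurd h' h
  calc ∫ ω, (∑ p ∈ s, Y p ω ^ 2) ^ 2 ∂P
      ≤ ∫ ω, (∑ p ∈ s, v p) * ∑ p ∈ s, Y p ω ^ 4 / v p ∂P := by
        refine integral_mono_of_nonneg (ae_of_all _ fun _ => sq_nonneg _)
          ((integrable_finsetSum _ fun p _ => hi p).const_mul _) ?_
        filter_upwards [(Finset.eventually_all s).2 h0] with ω hω
        refine Finset.sum_sq_le_sum_mul_sum_of_sq_le_mul s (fun p _ => hv p)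
          (fun p _ => div_nonneg (by positivity) (hv p)) fun p hp => ?_
        by_cases h : v p = 0
        · simp [hω p hp h]
        · exact le_of_eq (by field_simp)
    _ = (∑ p ∈ s, v p) * ∑ p ∈ s, 3 * v p := by
        rw [integral_const_mul, integral_finsetSum _ fun p _ => hi p]
        congr 1
        refine Finset.sum_congr rfl fun p _ => ?_
        rw [integral_div, integral_pow_four_of_hasLaw_gaussianReal (hv p) (hY p)]
        by_cases h : v p = 0
        · simp [h]
        · field_simp
    _ = 3 * (∑ p ∈ s, v p) ^ 2 := by rw [← Finset.mul_sum]; ring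

end SumSq

section Bilinear

variable {ι Ω : Type*} [Fintype ι] [MeasurableSpace Ω] {P : Measure Ω}
  {u v : Ω → ι → ℝ} {S R M : Matrix ι ι ℝ}

theorem memLp_four_bilinear (hu : IsCenteredGaussian u S P) (hv : IsCenteredGaussian v R P)
    (huv : IndepFun u v P) (M : Matrix ι ι ℝ) : MemLp (fun ω => u ω ⬝ᵥ M *ᵥ v ω) 4 P := by
  have h : ∀ i j, MemLp (fun ω => u ω i * v ω j) 4 P := by
    intro i j
    have h4 : ∀ {w : Ω → ι → ℝ} {Q : Matrix ι ι ℝ}, IsCenteredGaussian w Q P → ∀ i,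
        Integrable (fun ω => w ω i ^ 4) P := by
      intro w Q hw i
      have := (hw.memLp i (p := 4) (by norm_num)).integrable_norm_pow (by norm_num)
      simpa [Even.pow_abs (show Even 4 by decide)] using this
    have hi : Integrable (fun ω => u ω i ^ 4 * v ω j ^ 4) P :=
      (huv.comp (φ := fun x : ι → ℝ => x i ^ 4) (ψ := fun x : ι → ℝ => x j ^ 4) (by fun_prop)
        (by fun_prop)).integrable_mul (h4 hu i) (h4 hv j)
    have hm : AEStronglyMeasurable (fun ω => u ω i * v ω j) P :=
      (hu.memLp i (p := 4) (by norm_num)).1.mul (hv.memLp j (p := 4) (by norm_num)).1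
    refine (integrable_norm_rpow_iff hm (p := 4) (by norm_num) (by norm_num)).1 ?_
    refine hi.congr (ae_of_all _ fun ω => ?_)
    simp [mul_pow, Even.pow_abs (show Even 4 by decide)]
  have he : (fun ω => u ω ⬝ᵥ M *ᵥ v ω) = fun ω => ∑ i, ∑ j, M i j * (u ω i * v ω j) := by
    ext ω
    simp only [dotProduct, Matrix.mulVec, Finset.mul_sum]
    refine Finset.sum_congr rfl fun i _ => Finset.sum_congr rfl fun j _ => ?_
    ring
  rw [he]
  exact memLp_finsetSum _ fun i _ => memLp_finsetSum _ fun j _ => (h i j).const_mul _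

open scoped MatrixOrder in
theorem exists_eq_conjTranspose_mul_self (hS : S.PosSemidef) : ∃ B : Matrix ι ι ℝ, S = Bᴴ * B := by
  classical
  exact CStarAlgebra.nonneg_iff_eq_star_mul_self.1 hS.nonneg

theorem dotProduct_conjTranspose_mul_self_mulVec {κ : Type*} [Fintype κ] (B : Matrix κ ι ℝ)
    (x : ι → ℝ) : x ⬝ᵥ (Bᴴ * B) *ᵥ x = ∑ p, (B p ⬝ᵥ x) ^ 2 := by
  rw [← Matrix.mulVec_mulVec, Matrix.dotProduct_mulVec,
    Matrix.conjTranspose_eq_transpose_of_trivial, Matrix.vecMul_transpose]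
  simp only [dotProduct, Matrix.mulVec, sq]

/-- Integrating out the first vector of a bilinear form in independent normal vectors. -/
theorem integral_pow_bilinear [IsProbabilityMeasure P] (hu : IsCenteredGaussian u S P)
    (hv : IsCenteredGaussian v R P) (huv : IndepFun u v P) (n : ℕ)
    (hi : Integrable (fun ω => (u ω ⬝ᵥ M *ᵥ v ω) ^ n) P) :
    ∫ ω, (u ω ⬝ᵥ M *ᵥ v ω) ^ n ∂P = ∫ ω, ∫ ω', (M *ᵥ v ω ⬝ᵥ u ω') ^ n ∂P ∂P := by
  have hum := hu.gaussian.aemeasurable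
  have hvm := hv.gaussian.aemeasurable
  have hc : Continuous fun p : (ι → ℝ) × (ι → ℝ) => (p.2 ⬝ᵥ M *ᵥ p.1) ^ n := by fun_prop
  have hmap := (indepFun_iff_map_prod_eq_prod_map_map hvm hum).1 huv.symm
  have : IsProbabilityMeasure (P.map u) := Measure.isProbabilityMeasure_map hum
  have : IsProbabilityMeasure (P.map v) := Measure.isProbabilityMeasure_map hvm
  have hi' : Integrable (fun p : (ι → ℝ) × (ι → ℝ) => (p.2 ⬝ᵥ M *ᵥ p.1) ^ n)
      ((P.map v).prod (P.map u)) := by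
    rw [← hmap, integrable_map_measure hc.aestronglyMeasurable (hvm.prodMk hum)]
    exact hi
  calc ∫ ω, (u ω ⬝ᵥ M *ᵥ v ω) ^ n ∂P
      = ∫ p, (p.2 ⬝ᵥ M *ᵥ p.1) ^ n ∂(P.map fun ω => (v ω, u ω)) := by
        rw [integral_map (hvm.prodMk hum) hc.aestronglyMeasurable]
    _ = ∫ y, ∫ x, (x ⬝ᵥ M *ᵥ y) ^ n ∂(P.map u) ∂(P.map v) := by
        rw [hmap, integral_prod _ hi']
    _ = ∫ ω, ∫ x, (x ⬝ᵥ M *ᵥ v ω) ^ n ∂(P.map u) ∂P := by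
        rw [integral_map hvm hi'.integral_prod_left.aestronglyMeasurable]
    _ = _ := by
        refine integral_congr_ae (ae_of_all _ fun ω => ?_)
        simp only
        rw [integral_map hum (by fun_prop)]
        simp_rw [dotProduct_comm (M *ᵥ v ω)]

/-- Second and fourth moments of a bilinear form in independent normal vectors. With `S = Bᴴ B`, the
conditional variance given `v` is `‖B M v‖²`, a sum of squares of normal variables. -/
theorem bilinear_moments [IsProbabilityMeasure P] (hu : IsCenteredGaussian u S P)
    (hv : IsCenteredGaussian v R P) (huv : IndepFun u v P) (hS : S.PosSemidef)
    (hR : R.PosSemidef) (hM : M.IsSymm) :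
    ∫ ω, (u ω ⬝ᵥ M *ᵥ v ω) ^ 2 ∂P = (M * S * (M * R)).trace ∧
      ∫ ω, (u ω ⬝ᵥ M *ᵥ v ω) ^ 4 ∂P ≤ 9 * ((M * S * (M * R)).trace) ^ 2 := by
  obtain ⟨B, hB⟩ := exists_eq_conjTranspose_mul_self hS
  have h4 := memLp_four_bilinear hu hv huv M
  have h4i : Integrable (fun ω => (u ω ⬝ᵥ M *ᵥ v ω) ^ 4) P := by
    simpa [Even.pow_abs (show Even 4 by decide)] using h4.integrable_norm_pow (by norm_num)
  have h2i : Integrable (fun ω => (u ω ⬝ᵥ M *ᵥ v ω) ^ 2) P :=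
    (h4.mono_exponent (by norm_num)).integrable_sq
  have hc0 : ∀ c : ι → ℝ, 0 ≤ c ⬝ᵥ S *ᵥ c := fun c => by
    simpa using hS.dotProduct_mulVec_nonneg c
  have hr0 : ∀ c : ι → ℝ, 0 ≤ c ⬝ᵥ R *ᵥ c := fun c => by
    simpa using hR.dotProduct_mulVec_nonneg c
  have hq : ∀ ω, M *ᵥ v ω ⬝ᵥ S *ᵥ (M *ᵥ v ω) = ∑ p, ((B * M) p ⬝ᵥ v ω) ^ 2 := fun ω => by
    rw [hB, dotProduct_conjTranspose_mul_self_mulVec]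
    refine Finset.sum_congr rfl fun p _ => ?_
    congr 1
    change (B *ᵥ (M *ᵥ v ω)) p = ((B * M) *ᵥ v ω) p
    rw [Matrix.mulVec_mulVec]
  have htr : ∑ p, (B * M) p ⬝ᵥ R *ᵥ (B * M) p = (M * S * (M * R)).trace := by
    have e1 : ∀ A : Matrix ι ι ℝ, ∑ p, A p ⬝ᵥ R *ᵥ A p = (A * R * Aᵀ).trace := fun A => by
      simp only [Matrix.trace, Matrix.diag, Matrix.mul_assoc]
      exact Finset.sum_congr rfl fun p _ => by simp [Matrix.mul_apply, dotProduct, Matrix.mulVec]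
    rw [e1, hB, Matrix.transpose_mul, hM.eq, Matrix.conjTranspose_eq_transpose_of_trivial,
      Matrix.trace_mul_comm]
    simp only [Matrix.mul_assoc]
  constructor
  · rw [integral_pow_bilinear hu hv huv 2 h2i, ← htr,
      ← integral_sum_sq_of_gaussianReal (P := P) (Y := fun p ω => (B * M) p ⬝ᵥ v ω) Finset.univ
        (fun p => hr0 _) fun p => hv.hasLaw_dotProduct _]
    refine integral_congr_ae (ae_of_all _ fun ω => ?_)
    simp only
    rw [integral_sq_of_hasLaw_gaussianReal (hc0 _) (hu.hasLaw_dotProduct _), hq]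
  · rw [integral_pow_bilinear hu hv huv 4 h4i, ← htr]
    have h := integral_sq_sum_sq_le (P := P) (Y := fun p ω => (B * M) p ⬝ᵥ v ω) Finset.univ
      (fun p => hr0 _) fun p => hv.hasLaw_dotProduct _
    calc _ = ∫ ω, 3 * (∑ p, ((B * M) p ⬝ᵥ v ω) ^ 2) ^ 2 ∂P := by
          refine integral_congr_ae (ae_of_all _ fun ω => ?_)
          simp only
          rw [integral_pow_four_of_hasLaw_gaussianReal (hc0 _) (hu.hasLaw_dotProduct _), hq]
      _ ≤ _ := by
          rw [integral_const_mul]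
          linarith

end Bilinear

/-! ### Quadratic forms in a normal vector -/

section Spectral

variable {ι : Type*} [Fintype ι]

theorem trace_projection_sandwich {T S : Matrix ι ι ℝ} (hT : IsIdempotentElem T) :
    (T * S * T).trace = (T * S).trace := by
  rw [Matrix.trace_mul_comm, ← Matrix.mul_assoc, hT.eq]

theorem isHermitian_projection_sandwich {T S : Matrix ι ι ℝ} (hS : S.PosSemidef) (hTs : T.IsSymm) :
    (T * S * T).IsHermitian := by
  have h := (hS.mul_mul_conjTranspose_same T).isHermitian
  rwa [Matrix.conjTranspose_eq_transpose_of_trivial, hTs.eq] at h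

theorem trace_sq_projection_sandwich {T S : Matrix ι ι ℝ} (hT : IsIdempotentElem T) :
    (T * S * T * (T * S * T)).trace = (T * S * (T * S)).trace := by
  have : T * S * T * (T * S * T) = T * (S * T * S) * T := by
    rw [show T * S * T * (T * S * T) = T * S * (T * T) * S * T by simp only [Matrix.mul_assoc],
      hT.eq]
    simp only [Matrix.mul_assoc]
  rw [this, trace_projection_sandwich hT]
  simp only [Matrix.mul_assoc]

variable [DecidableEq ι] {A : Matrix ι ι ℝ}

theorem sum_eigenvalues_eq_trace (hA : A.IsHermitian) : ∑ i, hA.eigenvalues i = A.trace := by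
  simpa using hA.trace_eq_sum_eigenvalues.symm

theorem sum_sq_eigenvalues_eq_trace (hA : A.IsHermitian) :
    ∑ i, hA.eigenvalues i ^ 2 = (A * A).trace := by
  conv_rhs => rw [hA.spectral_theorem, ← map_mul, Unitary.conjStarAlgAut_apply,
    Matrix.trace_mul_comm, ← mul_assoc, Unitary.coe_star_mul_self, one_mul,
    Matrix.diagonal_mul_diagonal, Matrix.trace_diagonal]
  simp [sq]

end Spectral

section QuadraticForm

variable {ι Ω : Type*} [Fintype ι] [MeasurableSpace Ω] {Z : Ω → ι → ℝ}
  {S T : Matrix ι ι ℝ} {P : Measure Ω}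

theorem memLp_two_quadraticForm (hZ : IsCenteredGaussian Z S P) (T : Matrix ι ι ℝ) :
    MemLp (fun ω => Z ω ⬝ᵥ T *ᵥ Z ω) 2 P := by
  simp only [dotProduct, Matrix.mulVec]
  refine memLp_finsetSum _ fun i _ => ?_
  have h : MemLp (fun ω => ∑ j, T i j * Z ω j) 4 P :=
    memLp_finsetSum _ fun j _ => (hZ.memLp j (by norm_num)).const_mul _
  have : ENNReal.HolderTriple 4 4 2 := ⟨by
    rw [← two_mul]
    refine (ENNReal.eq_inv_of_mul_eq_one_left ?_)
    rw [show (4 : ENNReal) = 2 * 2 by norm_num, ENNReal.mul_inv (by simp) (by simp)]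
    rw [← mul_assoc, ENNReal.mul_inv_cancel (by simp) (by simp), one_mul,
      ENNReal.inv_mul_cancel (by simp) (by simp)]⟩
  exact h.mul (hZ.memLp i (p := 4) (by norm_num))

theorem hasLaw_stdChiSq_of_sq_gaussianReal {w : Ω → ℝ} {l σ : ℝ} (hl : 0 ≤ l)
    (hw : HasLaw w (gaussianReal 0 l.toNNReal) P) :
    P.map (fun ω => (w ω ^ 2 - l) / (√2 * σ)) = stdChiSq.map (fun x => l / σ * x) := by
  have e1 : P.map (fun ω => (w ω ^ 2 - l) / (√2 * σ)) =
      (P.map w).map (fun x => (x ^ 2 - l) / (√2 * σ)) := by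
    rw [AEMeasurable.map_map_of_aemeasurable (by fun_prop) hw.aemeasurable]
    rfl
  rw [e1, hw.map_eq, ← (hasLaw_sqrt_mul_gaussianReal hl).map_eq,
    ← hasLaw_stdChiSq_of_gaussianReal.map_eq, Measure.map_map (by fun_prop) (by fun_prop),
    Measure.map_map (by fun_prop) (by fun_prop)]
  congr 1
  ext x
  simp only [Function.comp, mul_pow, Real.sq_sqrt hl]
  ring

variable [DecidableEq ι]

/-- **Principal axes.** The coordinates of `T Z` along the eigenvectors of its covariance matrix
`T S T` are uncorrelated, hence independent, and the quadratic form is the sum of their squares. -/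
theorem exists_indep_principal_axes (hZ : IsCenteredGaussian Z S P) (hS : S.PosSemidef)
    (hTs : T.IsSymm) (hT : IsIdempotentElem T) (hH : (T * S * T).IsHermitian) :
    (∀ i, 0 ≤ hH.eigenvalues i) ∧ ∃ w : ι → Ω → ℝ, iIndepFun w P ∧
      (∀ i, HasLaw (w i) (gaussianReal 0 (hH.eigenvalues i).toNNReal) P) ∧
      ∀ ω, Z ω ⬝ᵥ T *ᵥ Z ω = ∑ i, w i ω ^ 2 := by
  have hpos : (T * S * T).PosSemidef := by
    have h := hS.mul_mul_conjTranspose_same T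
    rwa [Matrix.conjTranspose_eq_transpose_of_trivial, hTs.eq] at h
  let e := hH.eigenvectorBasis
  have hcomm : ∀ (c : ι → ℝ) ω, c ⬝ᵥ T *ᵥ Z ω = (T *ᵥ c) ⬝ᵥ Z ω := fun c ω => by
    rw [Matrix.dotProduct_mulVec, ← Matrix.mulVec_transpose, hTs.eq]
  let w : ι → Ω → ℝ := fun i ω => (T *ᵥ (e i).ofLp) ⬝ᵥ Z ω
  have hcov : ∀ i j, (T *ᵥ (e i).ofLp) ⬝ᵥ S *ᵥ (T *ᵥ (e j).ofLp) =
      if i = j then hH.eigenvalues j else 0 := by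
    intro i j
    have h1 : (T *ᵥ (e i).ofLp) ⬝ᵥ S *ᵥ (T *ᵥ (e j).ofLp) =
        (e i).ofLp ⬝ᵥ (T * S * T) *ᵥ (e j).ofLp := by
      rw [← Matrix.mulVec_mulVec, ← Matrix.mulVec_mulVec, Matrix.dotProduct_mulVec _ T,
        ← Matrix.mulVec_transpose, hTs.eq]
    have h2 := orthonormal_iff_ite.1 e.orthonormal i j
    rw [EuclideanSpace.inner_eq_star_dotProduct, star_trivial, dotProduct_comm] at h2
    rw [h1, hH.mulVec_eigenvectorBasis, dotProduct_smul, h2]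
    simp
  have hgauss : HasGaussianLaw (fun ω i => w i ω) P := by
    have := hZ.gaussian.map_fun (ContinuousLinearMap.pi fun i => ∑ j, (T *ᵥ (e i).ofLp) j •
      ContinuousLinearMap.proj (R := ℝ) (φ := fun _ => ℝ) j)
    convert! this using 3
    simp [w, dotProduct]
  refine ⟨hpos.eigenvalues_nonneg, w, ?_, fun i => ?_, fun ω => ?_⟩
  · refine hgauss.iIndepFun_of_covariance_eq_zero fun i j hij => ?_
    rw [hZ.cov_dotProduct, hcov, if_neg hij]
  · have := hZ.hasLaw_dotProduct (T *ᵥ (e i).ofLp)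
    rwa [hcov, if_pos rfl] at this
  · have h1 : Z ω ⬝ᵥ T *ᵥ Z ω = T *ᵥ Z ω ⬝ᵥ T *ᵥ Z ω := by
      rw [hcomm (T *ᵥ Z ω), Matrix.mulVec_mulVec, hT.eq, dotProduct_comm]
    have h2 := e.sum_sq_inner_right (WithLp.toLp 2 (T *ᵥ Z ω))
    rw [EuclideanSpace.real_norm_sq_eq] at h2
    rw [h1, dotProduct]
    simp only [← sq]
    rw [← h2]
    refine Finset.sum_congr rfl fun i _ => ?_
    rw [EuclideanSpace.inner_eq_star_dotProduct, star_trivial, dotProduct_comm, hcomm]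

theorem integral_quadraticForm (hZ : IsCenteredGaussian Z S P) (hS : S.PosSemidef)
    (hTs : T.IsSymm) (hT : IsIdempotentElem T) :
    ∫ ω, Z ω ⬝ᵥ T *ᵥ Z ω ∂P = (T * S).trace := by
  have hH := isHermitian_projection_sandwich hS hTs
  obtain ⟨h0, w, hw, hlaw, hq⟩ := exists_indep_principal_axes hZ hS hTs hT hH
  simp_rw [hq]
  rw [integral_sum_sq_of_gaussianReal _ h0 hlaw, sum_eigenvalues_eq_trace,
    trace_projection_sandwich hT]

theorem variance_quadraticForm (hZ : IsCenteredGaussian Z S P) (hS : S.PosSemidef)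
    (hTs : T.IsSymm) (hT : IsIdempotentElem T) :
    Var[fun ω => Z ω ⬝ᵥ T *ᵥ Z ω; P] = 2 * (T * S * (T * S)).trace := by
  have := hZ.gaussian.isProbabilityMeasure
  have hH := isHermitian_projection_sandwich hS hTs
  obtain ⟨h0, w, hw, hlaw, hq⟩ := exists_indep_principal_axes hZ hS hTs hT hH
  simp_rw [hq]
  have hi := fun i n => integrable_pow_of_hasLaw_gaussianReal (hlaw i) n
  have hL : ∀ i, MemLp (fun ω => w i ω ^ 2) 2 P := fun i => by
    rw [memLp_two_iff_integrable_sq (hi i 2).1]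
    simpa only [← pow_mul] using hi i 4
  have hv := IndepFun.variance_sum (μ := P) (s := Finset.univ) (X := fun i ω => w i ω ^ 2)
    (fun i _ => hL i) (fun i _ j _ hij => (hw.indepFun hij).comp (φ := fun x => x ^ 2)
      (ψ := fun x => x ^ 2) (by fun_prop) (by fun_prop))
  have hs : (∑ i, fun ω => w i ω ^ 2) = fun ω => ∑ i, w i ω ^ 2 := by
    ext ω; simp
  rw [hs] at hv
  rw [hv, ← trace_sq_projection_sandwich hT, ← sum_sq_eigenvalues_eq_trace hH, Finset.mul_sum]
  refine Finset.sum_congr rfl fun i _ => ?_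
  rw [variance_eq_sub (hL i)]
  simp only [Pi.pow_apply, ← pow_mul]
  rw [integral_sq_of_hasLaw_gaussianReal (h0 i) (hlaw i)]
  rw [integral_pow_four_of_hasLaw_gaussianReal (h0 i) (hlaw i)]
  ring

/-- The characteristic function of the standardized quadratic form, as the product over the
independent principal axes. -/
theorem charFun_standardized_quadraticForm (hZ : IsCenteredGaussian Z S P) (hS : S.PosSemidef)
    (hTs : T.IsSymm) (hT : IsIdempotentElem T) (hH : (T * S * T).IsHermitian) (t : ℝ) :
    charFun (P.map fun ω => (Z ω ⬝ᵥ T *ᵥ Z ω - (T * S).trace) /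
        √(2 * (T * S * (T * S)).trace)) t =
      ∏ i, charFun stdChiSq (hH.eigenvalues i / √(T * S * (T * S)).trace * t) := by
  obtain ⟨h0, w, hw, hlaw, hq⟩ := exists_indep_principal_axes hZ hS hTs hT hH
  have he : (fun ω => (Z ω ⬝ᵥ T *ᵥ Z ω - (T * S).trace) / √(2 * (T * S * (T * S)).trace)) =
      fun ω => ∑ i, (w i ω ^ 2 - hH.eigenvalues i) / (√2 * √(T * S * (T * S)).trace) := by
    ext ω
    rw [hq, ← trace_projection_sandwich hT, ← sum_eigenvalues_eq_trace hH,
      ← Finset.sum_sub_distrib, Finset.sum_div, Real.sqrt_mul (by norm_num)]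
  have hm := fun i => (hlaw i).aemeasurable
  have hind : iIndepFun
      (fun i ω => (w i ω ^ 2 - hH.eigenvalues i) / (√2 * √(T * S * (T * S)).trace)) P :=
    hw.comp (fun i x => (x ^ 2 - hH.eigenvalues i) / (√2 * √(T * S * (T * S)).trace))
      fun i => by fun_prop
  rw [he, hind.charFun_map_fun_sum_eq_prod (fun i => by fun_prop), Finset.prod_apply]
  refine Finset.prod_congr rfl fun i _ => ?_
  rw [hasLaw_stdChiSq_of_sq_gaussianReal (h0 i) (hlaw i)]
  have := charFun_map_mul (μ := stdChiSq) (hH.eigenvalues i / √(T * S * (T * S)).trace) t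
  exact this

end QuadraticForm

/-! ### Variance of averages of kernels with few dependent pairs -/

/-- Functions of disjoint finite sets of independent coordinates are independent. The point `x₀`
only serves to fill in the coordinates on which a function does not depend. -/
theorem indepFun_of_dependsOn {κ Ω : Type*} [MeasurableSpace Ω] {P : Measure Ω} {E : κ → Type*}
    [∀ p, MeasurableSpace (E p)] {X : (p : κ) → Ω → E p} (x₀ : (p : κ) → E p) (hX : iIndepFun X P)
    (hm : ∀ p, AEMeasurable (X p) P) {f g : ((p : κ) → E p) → ℝ} (hf : Measurable f)
    (hg : Measurable g) {S T : Finset κ} (hfS : DependsOn f (S : Set κ))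
    (hgT : DependsOn g (T : Set κ)) (hST : Disjoint S T) :
    IndepFun (fun ω => f fun p => X p ω) (fun ω => g fun p => X p ω) P := by
  classical
  -- a function of the coordinates in `S` factors through the restriction to `S`
  have key : ∀ {f : ((p : κ) → E p) → ℝ} {S : Finset κ}, DependsOn f (S : Set κ) → ∀ ω,
      (f fun p => X p ω) = f (Function.updateFinset x₀ S fun p : S => X p ω) := by
    intro f S h ω
    refine h fun p hp => ?_
    rw [Function.updateFinset, dif_pos (by exact hp)]
  simp_rw [key hfS, key hgT]
  exact (hX.indepFun_finset₀ S T hST hm).comp (φ := fun z => f (Function.updateFinset x₀ S z))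
    (ψ := fun z => g (Function.updateFinset x₀ T z)) (hf.comp measurable_updateFinset)
    (hg.comp measurable_updateFinset)

section Variance

variable {Ω : Type*} [MeasurableSpace Ω] {P : Measure Ω} [IsProbabilityMeasure P]

theorem covariance_le_of_variance_le {X Y : Ω → ℝ} (hX : MemLp X 2 P) (hY : MemLp Y 2 P) {K : ℝ}
    (hXK : Var[X; P] ≤ K) (hYK : Var[Y; P] ≤ K) : cov[X, Y; P] ≤ K := by
  have h := variance_nonneg (X - Y) P
  rw [variance_sub hX hY] at h
  linarith

/-- If each summand is related by `r` to at most `B` summands and is independent of all others, then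
at most `B` covariances per summand do not vanish. -/
theorem variance_sum_le_of_indepFun {J : Type*} (I : Finset J) {h : J → Ω → ℝ}
    (hL : ∀ p ∈ I, MemLp (h p) 2 P) {K : ℝ} (hK : ∀ p ∈ I, Var[h p; P] ≤ K) (r : J → J → Prop)
    [DecidableRel r] (hr : ∀ p ∈ I, ∀ q ∈ I, ¬ r p q → IndepFun (h p) (h q) P) {B : ℝ}
    (hK0 : 0 ≤ K) (hB : ∀ p ∈ I, ((I.filter (r p)).card : ℝ) ≤ B) :
    Var[fun ω => ∑ p ∈ I, h p ω; P] ≤ I.card * B * K := by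
  rw [← covariance_self (memLp_finsetSum I hL).aemeasurable, covariance_fun_sum_fun_sum' hL hL]
  calc ∑ p ∈ I, ∑ q ∈ I, cov[h p, h q; P] ≤ ∑ p ∈ I, B * K := by
        refine Finset.sum_le_sum fun p hp => ?_
        calc ∑ q ∈ I, cov[h p, h q; P] ≤ ∑ q ∈ I, if r p q then K else 0 := by
              refine Finset.sum_le_sum fun q hq => ?_
              split_ifs with hpq
              · exact covariance_le_of_variance_le (hL p hp) (hL q hq) (hK p hp) (hK q hq)
              · exact ((hr p hp q hq hpq).covariance_eq_zero (hL p hp) (hL q hq)).le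
          _ = (I.filter (r p)).card * K := by
              rw [← Finset.sum_filter, Finset.sum_const, nsmul_eq_mul]
          _ ≤ B * K := mul_le_mul_of_nonneg_right (hB p hp) hK0
    _ = I.card * B * K := by rw [Finset.sum_const, nsmul_eq_mul, mul_assoc]

theorem integral_abs_sub_le_sqrt_variance {X : Ω → ℝ} (hX : MemLp X 2 P) {m : ℝ}
    (hm : ∫ ω, X ω ∂P = m) : ∫ ω, |X ω - m| ∂P ≤ √Var[X; P] := by
  have hs : MemLp (fun ω => |X ω - m|) 2 P := (hX.sub (memLp_const m)).abs
  refine Real.le_sqrt_of_sq_le ?_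
  have h := variance_nonneg (fun ω => |X ω - m|) P
  rw [variance_eq_sub hs] at h
  rw [variance_eq_integral hX.aemeasurable, hm]
  simp only [Pi.pow_apply, sq_abs] at h
  linarith

end Variance

/-! ### Counting pairs and quadruples of observations -/

theorem card_filter_snd_lt_fst {α : Type*} [LinearOrder α] (s : Finset α) :
    ((s ×ˢ s).filter fun p => p.2 < p.1).card = s.card.choose 2 := by
  have hswap : ((s ×ˢ s).filter fun p => p.2 < p.1).card =
      ((s ×ˢ s).filter fun p => p.1 < p.2).card := by
    refine Finset.card_nbij' Prod.swap Prod.swap ?_ ?_ ?_ ?_ <;> intro p <;> simp <;> tauto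
  have hunion : s.offDiag = ((s ×ˢ s).filter fun p => p.2 < p.1) ∪
      (s ×ˢ s).filter fun p => p.1 < p.2 := by
    ext p
    simp only [Finset.mem_offDiag, Finset.mem_union, Finset.mem_filter, Finset.mem_product,
      ne_iff_lt_or_gt]
    tauto
  have hdisj : Disjoint ((s ×ˢ s).filter fun p => p.2 < p.1)
      ((s ×ˢ s).filter fun p => p.1 < p.2) := by
    rw [Finset.disjoint_filter]
    exact fun p _ h => h.not_gt
  have h := congrArg Finset.card hunion
  rw [Finset.card_union_of_disjoint hdisj, ← hswap, Finset.offDiag_card] at h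
  rw [Nat.choose_two_right, Nat.mul_sub, mul_one]
  omega

/-- The pairs `l₂ < l₁`, stored as `(l₁, l₂)`. -/
def orderedPairs (n : ℕ) : Finset (Fin n × Fin n) := Finset.univ.filter fun p => p.2 < p.1

/-- The pairs of pairs `l₂ < l₁`, `k₂ < k₁` of pairwise different indices, stored as
`((l₁, l₂), (k₁, k₂))`. -/
def disjointOrderedPairs (n : ℕ) : Finset ((Fin n × Fin n) × (Fin n × Fin n)) :=
  (orderedPairs n ×ˢ orderedPairs n).filter fun q =>
    q.2.1 ≠ q.1.1 ∧ q.2.1 ≠ q.1.2 ∧ q.2.2 ≠ q.1.1 ∧ q.2.2 ≠ q.1.2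

theorem card_orderedPairs (n : ℕ) : (orderedPairs n).card = n.choose 2 := by
  rw [orderedPairs, ← Finset.univ_product_univ, card_filter_snd_lt_fst, Finset.card_univ,
    Fintype.card_fin]

theorem card_disjointOrderedPairs (n : ℕ) :
    (disjointOrderedPairs n).card = 6 * n.choose 4 := by
  have h : (disjointOrderedPairs n).card =
      ∑ p ∈ orderedPairs n, (((Finset.univ \ {p.1, p.2}) ×ˢ (Finset.univ \ {p.1, p.2})).filter
        fun q : Fin n × Fin n => q.2 < q.1).card := by
    rw [disjointOrderedPairs, Finset.card_filter, Finset.sum_product]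
    refine Finset.sum_congr rfl fun p hp => ?_
    rw [← Finset.card_filter, orderedPairs, Finset.filter_filter]
    congr 1
    ext q
    simp
    tauto
  have hc : ∀ p ∈ orderedPairs n, (((Finset.univ \ {p.1, p.2}) ×ˢ (Finset.univ \ {p.1, p.2})).filter
        fun q : Fin n × Fin n => q.2 < q.1).card = (n - 2).choose 2 := by
    intro p hp
    have hne : p.1 ≠ p.2 := (Finset.mem_filter.1 hp).2.ne'
    rw [card_filter_snd_lt_fst, Finset.card_univ_sdiff, Finset.card_pair hne, Fintype.card_fin]
  rw [h, Finset.sum_congr rfl hc, Finset.sum_const, card_orderedPairs, smul_eq_mul]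
  have := Nat.choose_mul (n := n) (show 2 ≤ 4 by norm_num)
  rw [show Nat.choose 4 2 = 6 by rfl, show 4 - 2 = 2 by rfl] at this
  omega

theorem sq_le_card_orderedPairs {n : ℕ} (hn : 2 ≤ n) :
    (n : ℝ) ^ 2 ≤ 4 * (orderedPairs n).card := by
  rw [card_orderedPairs, Nat.cast_choose_two]
  have : (2 : ℝ) ≤ n := by exact_mod_cast hn
  nlinarith

theorem pow_four_le_card_disjointOrderedPairs {n : ℕ} (hn : 6 ≤ n) :
    (n : ℝ) ^ 4 ≤ 32 * (disjointOrderedPairs n).card := by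
  have h6 : (6 : ℝ) ≤ n := by exact_mod_cast hn
  have hc : ((n.choose 4 : ℕ) : ℝ) = n * ((n - 1) * (n - 2) * (n - 3)) / 24 := by
    rw [Nat.cast_choose_eq_ascPochhammer_div]
    simp only [ascPochhammer_succ_eval, ascPochhammer_zero, Polynomial.eval_one, Nat.factorial]
    push_cast [Nat.cast_sub (show 3 ≤ n by omega)]
    ring
  rw [card_disjointOrderedPairs]
  push_cast
  rw [hc]
  -- `6 ≤ n` gives `n / 2 ≤ n - 3`
  have h1 : (n : ℝ) / 2 * (n / 2) * (n / 2) ≤ (n - 1) * (n - 2) * (n - 3) := by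
    have e1 : (n : ℝ) / 2 ≤ n - 1 := by linarith
    have e2 : (n : ℝ) / 2 ≤ n - 2 := by linarith
    have e3 : (n : ℝ) / 2 ≤ n - 3 := by linarith
    have e0 : (0 : ℝ) ≤ n / 2 := by positivity
    exact mul_le_mul (mul_le_mul e1 e2 e0 (e0.trans e1)) e3 e0
      (mul_nonneg (e0.trans e1) (e0.trans e2))
  calc (n : ℝ) ^ 4 = 8 * (n * (n / 2 * (n / 2) * (n / 2))) := by ring
    _ ≤ 8 * (n * ((n - 1) * (n - 2) * (n - 3))) := by gcongr
    _ = _ := by ring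

section Meeting

variable {κ : Type*} [DecidableEq κ] {m m' : ℕ} {f : Fin m → κ} {g : Fin m' → κ}

theorem card_filter_not_disjoint_pair_le (hf : f.Injective) (A : Finset κ) :
    (Finset.univ.filter fun q : Fin m × Fin m => ¬Disjoint A {f q.1, f q.2}).card ≤
      A.card * (2 * m) := by
  have hsub : (Finset.univ.filter fun q : Fin m × Fin m => ¬Disjoint A {f q.1, f q.2}) ⊆
      A.biUnion fun x => (Finset.univ.filter fun q : Fin m × Fin m => f q.1 = x) ∪
        Finset.univ.filter fun q : Fin m × Fin m => f q.2 = x := by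
    intro q hq
    obtain ⟨x, hxA, hx⟩ := Finset.not_disjoint_iff.1 (Finset.mem_filter.1 hq).2
    simp only [Finset.mem_insert, Finset.mem_singleton] at hx
    simp only [Finset.mem_biUnion, Finset.mem_union, Finset.mem_filter, Finset.mem_univ, true_and]
    exact ⟨x, hxA, by tauto⟩
  refine (Finset.card_le_card hsub).trans (Finset.card_biUnion_le_card_mul _ _ _ fun x _ => ?_)
  have c1 : (Finset.univ.filter fun q : Fin m × Fin m => f q.1 = x).card ≤ m := by
    refine (Finset.card_le_card_of_injOn (t := Finset.univ) (fun q => q.2) (by simp) ?_).trans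
      (by simp)
    rintro ⟨a, b⟩ h ⟨a', b'⟩ h' hbb
    simp only [Finset.coe_filter, Finset.mem_univ, true_and, Set.mem_ofPred_eq] at h h' hbb
    simp [hf (h.trans h'.symm), hbb]
  have c2 : (Finset.univ.filter fun q : Fin m × Fin m => f q.2 = x).card ≤ m := by
    refine (Finset.card_le_card_of_injOn (t := Finset.univ) (fun q => q.1) (by simp) ?_).trans
      (by simp)
    rintro ⟨a, b⟩ h ⟨a', b'⟩ h' hbb
    simp only [Finset.coe_filter, Finset.mem_univ, true_and, Set.mem_ofPred_eq] at h h' hbb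
    simp [hf (h.trans h'.symm), hbb]
  exact (Finset.card_union_le _ _).trans (by omega)

theorem card_filter_not_disjoint_quadruple_le (hf : f.Injective) (hg : g.Injective)
    (A : Finset κ) :
    (Finset.univ.filter fun q : (Fin m × Fin m) × (Fin m' × Fin m') =>
      ¬Disjoint A {f q.1.1, f q.1.2, g q.2.1, g q.2.2}).card ≤
      A.card * (2 * m) * (m' * m') + m * m * (A.card * (2 * m')) := by
  have hsub : (Finset.univ.filter fun q : (Fin m × Fin m) × (Fin m' × Fin m') =>
      ¬Disjoint A {f q.1.1, f q.1.2, g q.2.1, g q.2.2}) ⊆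
      (Finset.univ.filter fun q : Fin m × Fin m => ¬Disjoint A {f q.1, f q.2}) ×ˢ Finset.univ ∪
      Finset.univ ×ˢ Finset.univ.filter fun q : Fin m' × Fin m' =>
        ¬Disjoint A {g q.1, g q.2} := by
    intro q hq
    have hq' := (Finset.mem_filter.1 hq).2
    simp only [Finset.disjoint_insert_right, Finset.disjoint_singleton_right, Finset.mem_union,
      Finset.mem_product, Finset.mem_filter, Finset.mem_univ, true_and, and_true] at hq' ⊢
    tauto
  refine (Finset.card_le_card hsub).trans ((Finset.card_union_le _ _).trans ?_)
  rw [Finset.card_product, Finset.card_product]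
  refine add_le_add ?_ ?_
  · refine Nat.mul_le_mul (card_filter_not_disjoint_pair_le hf A) ?_
    simp
  · refine Nat.mul_le_mul ?_ (card_filter_not_disjoint_pair_le hg A)
    simp

end Meeting

/-! ### Normal vectors in the split-plot model -/

theorem hasGaussianLaw_sub_const {ι Ω : Type*} [Fintype ι] [MeasurableSpace Ω] {P : Measure Ω}
    {Z : Ω → ι → ℝ} (hZ : HasGaussianLaw Z P) (c : ι → ℝ) :
    HasGaussianLaw (fun ω => Z ω - c) P where
  isGaussian_map := by
    have := hZ.isGaussian_map
    have h : P.map (fun ω => Z ω - c) = (P.map Z).map fun z => z - c := by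
      rw [AEMeasurable.map_map_of_aemeasurable (by fun_prop) hZ.aemeasurable]
      rfl
    rw [h]
    infer_instance

namespace SplitPlotDesign

section Model

variable {D : SplitPlotDesign} {Ω : Type*} [MeasurableSpace Ω]
  {X : (i : Fin D.a) → Fin (D.n i) → Ω → EuclideanSpace ℝ (Fin D.d)} {P : Measure Ω}

theorem IsModel.hasGaussianLaw (hX : D.IsModel X P) (i : Fin D.a) (j : Fin (D.n i)) :
    HasGaussianLaw (X i j) P :=
  (hX.hasLaw i j).hasGaussianLaw

theorem IsModel.aemeasurable (hX : D.IsModel X P) (i : Fin D.a) (j : Fin (D.n i)) :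
    AEMeasurable (X i j) P :=
  (hX.hasLaw i j).aemeasurable

theorem IsModel.hasGaussianLaw_eval (hX : D.IsModel X P) (i : Fin D.a) (j : Fin (D.n i))
    (t : Fin D.d) : HasGaussianLaw (fun ω => X i j ω t) P :=
  (hX.hasGaussianLaw i j).map_fun (EuclideanSpace.proj (𝕜 := ℝ) t)

theorem IsModel.integral_eval (hX : D.IsModel X P) (i : Fin D.a) (j : Fin (D.n i))
    (t : Fin D.d) : ∫ ω, X i j ω t ∂P = D.mean i t := by
  have h := (hX.hasLaw i j).integral_comp (f := fun x => x t) (by fun_prop)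
  have h2 := (EuclideanSpace.proj (𝕜 := ℝ) t).integral_comp_comm
    (μ := multivariateGaussian (D.mean i) (D.cov i)) (φ := fun x => x) IsGaussian.integrable_fun_id
  simp only [Function.comp_def] at h
  rw [h]
  simpa using h2

theorem IsModel.cov_eval (hX : D.IsModel X P) (i : Fin D.a) (j : Fin (D.n i))
    (t t' : Fin D.d) : cov[fun ω => X i j ω t, fun ω => X i j ω t'; P] = D.cov i t t' := by
  have h := (hX.hasLaw i j).covariance_fun_comp (f := fun x => x t) (g := fun x => x t')
    (by fun_prop) (by fun_prop)
  rw [h, covariance_eval_multivariateGaussian (D.cov_posDef i).posSemidef]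

theorem IsModel.cov_eval_of_ne (hX : D.IsModel X P) {p q : (i : Fin D.a) × Fin (D.n i)}
    (hpq : p ≠ q) (t t' : Fin D.d) :
    cov[fun ω => X p.1 p.2 ω t, fun ω => X q.1 q.2 ω t'; P] = 0 := by
  have h := (hX.indep.indepFun hpq).comp (φ := fun x => x t) (ψ := fun x => x t')
    (by fun_prop) (by fun_prop)
  exact h.covariance_eq_zero (hX.hasGaussianLaw_eval _ _ _).memLp_two
    (hX.hasGaussianLaw_eval _ _ _).memLp_two

theorem IsModel.isCenteredGaussian_sub (hX : D.IsModel X P) (i : Fin D.a)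
    {l₁ l₂ : Fin (D.n i)} (hl : l₁ ≠ l₂) :
    IsCenteredGaussian (fun ω => (X i l₁ ω - X i l₂ ω).ofLp) ((2 : ℝ) • D.cov i) P := by
  have hne : (⟨i, l₁⟩ : (i : Fin D.a) × Fin (D.n i)) ≠ ⟨i, l₂⟩ := by simpa using hl
  have hm : ∀ l t, MemLp (fun ω => X i l ω t) 2 P := fun l t =>
    (hX.hasGaussianLaw_eval i l t).memLp_two
  have := (hX.hasGaussianLaw i l₁).isProbabilityMeasure
  refine ⟨?_, fun t => ?_, fun t t' => ?_⟩
  · have h := ((hX.indep.indepFun hne).hasGaussianLaw (hX.hasGaussianLaw i l₁)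
      (hX.hasGaussianLaw i l₂)).fun_sub
    exact h.map_equiv_fun (EuclideanSpace.equiv (Fin D.d) ℝ)
  · simp only [PiLp.sub_apply]
    rw [integral_sub ((hm _ _).integrable (by norm_num)) ((hm _ _).integrable (by norm_num)),
      hX.integral_eval, hX.integral_eval, sub_self]
  · simp only [PiLp.sub_apply]
    rw [covariance_fun_sub_fun_sub (hm _ _) (hm _ _) (hm _ _) (hm _ _), hX.cov_eval, hX.cov_eval,
      hX.cov_eval_of_ne hne, hX.cov_eval_of_ne hne.symm, Matrix.smul_apply, smul_eq_mul]
    ring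

theorem IsModel.indepFun_sub_sub (hX : D.IsModel X P) {p₁ p₂ q₁ q₂ : (i : Fin D.a) × Fin (D.n i)}
    (h₁ : p₁ ≠ q₁) (h₂ : p₁ ≠ q₂) (h₃ : p₂ ≠ q₁) (h₄ : p₂ ≠ q₂) :
    IndepFun (fun ω => (X p₁.1 p₁.2 ω - X p₂.1 p₂.2 ω).ofLp)
      (fun ω => (X q₁.1 q₁.2 ω - X q₂.1 q₂.2 ω).ofLp) P :=
  (hX.indep.indepFun_prodMk_prodMk₀ (fun p => hX.aemeasurable p.1 p.2) p₁ p₂ q₁ q₂ h₁ h₂ h₃ h₄).comp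
    (φ := fun x : EuclideanSpace ℝ (Fin D.d) × EuclideanSpace ℝ (Fin D.d) => (x.1 - x.2).ofLp)
    (ψ := fun x : EuclideanSpace ℝ (Fin D.d) × EuclideanSpace ℝ (Fin D.d) => (x.1 - x.2).ofLp)
    (by fun_prop) (by fun_prop)

theorem V_apply (D : SplitPlotDesign) (p q : Fin D.a × Fin D.d) :
    D.V p q = if p.1 = q.1 then (D.N : ℝ) / D.n p.1 * D.cov p.1 p.2 q.2 else 0 := by
  simp [V, Matrix.blockDiagonal_apply]

/-- The scaled centred group means `√N (X̄ i - μ i)`, stacked. -/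
noncomputable def centeredMean (D : SplitPlotDesign)
    (x : D.Data) (p : Fin D.a × Fin D.d) : ℝ :=
  √D.N * (D.groupMean x p.1 p.2 - D.mean p.1 p.2)

theorem groupMean_apply (D : SplitPlotDesign) (x : D.Data) (i : Fin D.a) (t : Fin D.d) :
    D.groupMean x i t = (D.n i : ℝ)⁻¹ * ∑ j, x i j t := by
  simp [groupMean]

theorem IsModel.isCenteredGaussian_centeredMean (hX : D.IsModel X P) (hn : ∀ i, 0 < D.n i) :
    IsCenteredGaussian (fun ω => D.centeredMean fun i j => X i j ω) D.V P := by
  have hP := hX.indep.isProbabilityMeasure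
  have hm : ∀ i j t, MemLp (fun ω => X i j ω t) 2 P := fun i j t =>
    (hX.hasGaussianLaw_eval i j t).memLp_two
  have hi : ∀ i j t, Integrable (fun ω => X i j ω t) P := fun i j t =>
    (hm i j t).integrable (by norm_num)
  have hs : ∀ i t, MemLp (fun ω => ∑ j, X i j ω t) 2 P := fun i t =>
    memLp_finsetSum _ fun j _ => hm i j t
  have hn0 : ∀ i, (D.n i : ℝ) ≠ 0 := fun i => by exact_mod_cast (hn i).ne'
  refine ⟨?_, fun p => ?_, fun p q => ?_⟩
  · have hj := iIndepFun.hasGaussianLaw (fun p : (i : Fin D.a) × Fin (D.n i) =>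
      hX.hasGaussianLaw p.1 p.2) hX.indep
    have hl := hj.map_fun (ContinuousLinearMap.pi fun q : Fin D.a × Fin D.d =>
      (√D.N * (D.n q.1 : ℝ)⁻¹) • ∑ j : Fin (D.n q.1), (EuclideanSpace.proj (𝕜 := ℝ) q.2).comp
        (ContinuousLinearMap.proj (R := ℝ)
          (φ := fun _ : (i : Fin D.a) × Fin (D.n i) => EuclideanSpace ℝ (Fin D.d)) ⟨q.1, j⟩))
    convert! hasGaussianLaw_sub_const hl fun p => √D.N * D.mean p.1 p.2 using 2 with ω
    ext p
    simp [centeredMean, groupMean_apply, mul_sub, mul_assoc]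
  · simp only [centeredMean, groupMean_apply]
    rw [integral_const_mul, integral_sub (((hs _ _).integrable (by norm_num)).const_mul _)
      (integrable_const _), integral_const_mul, integral_finsetSum _ fun j _ => hi _ _ _]
    simp [hX.integral_eval, hn0]
  · simp only [centeredMean, groupMean_apply]
    rw [covariance_const_mul_left, covariance_const_mul_right,
      covariance_sub_const_left (((hs _ _).integrable (by norm_num)).const_mul _),
      covariance_sub_const_right (((hs _ _).integrable (by norm_num)).const_mul _),
      covariance_const_mul_left, covariance_const_mul_right,
      covariance_fun_sum_fun_sum (fun _ => hm _ _ _) (fun _ => hm _ _ _), V_apply]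
    obtain ⟨i, t⟩ := p
    obtain ⟨r, t'⟩ := q
    have hN : √(D.N : ℝ) * √(D.N : ℝ) = D.N := Real.mul_self_sqrt (by positivity)
    simp only
    split_ifs with h
    · subst h
      have : ∀ j j' : Fin (D.n i), cov[fun ω => X i j ω t, fun ω => X i j' ω t'; P] =
          if j = j' then D.cov i t t' else 0 := by
        intro j j'
        split_ifs with hj
        · rw [hj, hX.cov_eval]
        · exact hX.cov_eval_of_ne (p := ⟨i, j⟩) (q := ⟨i, j'⟩) (by simpa using hj) t t'
      simp only [this, Finset.sum_ite_eq, Finset.mem_univ, if_true, Finset.sum_const,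
        Finset.card_univ, Fintype.card_fin, nsmul_eq_mul]
      rw [← mul_assoc, hN]
      have := hn0 i
      field_simp
    · have : ∀ (j : Fin (D.n i)) (j' : Fin (D.n r)),
          cov[fun ω => X i j ω t, fun ω => X r j' ω t'; P] = 0 := fun j j' =>
        hX.cov_eval_of_ne (p := ⟨i, j⟩) (q := ⟨r, j'⟩) (fun e => h (congrArg Sigma.fst e)) t t'
      simp [this]

end Model

/-! ### The quadratic form and its null moments -/

section Matrices

variable (D : SplitPlotDesign)

theorem T_symm : D.T.IsSymm := by
  ext p q
  simp [T, D.TW_symm.apply, D.TS_symm.apply]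

theorem T_idem : IsIdempotentElem D.T := by
  rw [IsIdempotentElem, T, ← Matrix.mul_kronecker_mul, D.TW_idem.eq, D.TS_idem.eq]

theorem T_apply (p q : Fin D.a × Fin D.d) : D.T p q = D.TW p.1 q.1 * D.TS p.2 q.2 := rfl

theorem T_mul_V_apply (p q : Fin D.a × Fin D.d) :
    (D.T * D.V) p q = D.TW p.1 q.1 * ((D.N : ℝ) / D.n q.1) * (D.TS * D.cov q.1) p.2 q.2 := by
  simp only [Matrix.mul_apply, Fintype.sum_prod_type, T_apply, V_apply]
  rw [Finset.sum_eq_single q.1 (fun i _ hi => by simp [hi]) (by simp), Finset.mul_sum]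
  refine Finset.sum_congr rfl fun t _ => ?_
  simp
  ring

/-- `tr (TS Σ i TS Σ r)`, the quantity that `A_{i,r,2}` and, for `i = r`, `A_{i,3}` estimate. -/
noncomputable def traceProd (i r : Fin D.a) : ℝ :=
  (D.TS * D.cov i * (D.TS * D.cov r)).trace

theorem trace_T_mul_V :
    (D.T * D.V).trace = ∑ i, (D.N : ℝ) / D.n i * D.TW i i * (D.TS * D.cov i).trace := by
  simp only [Matrix.trace, Matrix.diag, T_mul_V_apply, Fintype.sum_prod_type, Finset.mul_sum]
  refine Finset.sum_congr rfl fun i _ => Finset.sum_congr rfl fun t _ => ?_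
  ring

theorem trace_T_mul_V_sq : (D.T * D.V * (D.T * D.V)).trace =
    ∑ i, ∑ r, (D.N : ℝ) ^ 2 / (D.n i * D.n r) * D.TW i r ^ 2 * D.traceProd i r := by
  simp only [Matrix.trace, Matrix.diag, Matrix.mul_apply (M := D.T * D.V), T_mul_V_apply,
    Fintype.sum_prod_type, traceProd]
  refine Finset.sum_congr rfl fun i _ => ?_
  rw [Finset.sum_comm]
  refine Finset.sum_congr rfl fun r _ => ?_
  simp only [Finset.mul_sum, Matrix.mul_apply (M := D.TS * D.cov i)]
  rw [Finset.sum_comm]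
  refine Finset.sum_congr rfl fun t _ => Finset.sum_congr rfl fun t' _ => ?_
  rw [D.TW_symm.apply i r]
  ring

theorem traceProd_comm (i r : Fin D.a) : D.traceProd i r = D.traceProd r i :=
  Matrix.trace_mul_comm _ _

/-- With `Σ i = Bᴴ B` and `Σ r = Cᴴ C`, `tr (TS Σ i TS Σ r)` is the squared Frobenius norm of
`B TS Cᴴ`. -/
theorem exists_traceProd_eq (i r : Fin D.a) : ∃ B C : Matrix (Fin D.d) (Fin D.d) ℝ,
    D.cov i = Bᴴ * B ∧ D.cov r = Cᴴ * C ∧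
      D.traceProd i r = ((B * D.TS * Cᴴ)ᴴ * (B * D.TS * Cᴴ)).trace := by
  obtain ⟨B, hB⟩ := exists_eq_conjTranspose_mul_self (D.cov_posDef i).posSemidef
  obtain ⟨C, hC⟩ := exists_eq_conjTranspose_mul_self (D.cov_posDef r).posSemidef
  refine ⟨B, C, hB, hC, ?_⟩
  have hT : D.TSᴴ = D.TS := by
    rw [Matrix.conjTranspose_eq_transpose_of_trivial, D.TS_symm.eq]
  rw [traceProd, hB, hC, Matrix.conjTranspose_mul, Matrix.conjTranspose_mul,
    Matrix.conjTranspose_conjTranspose, hT, ← Matrix.mul_assoc, ← Matrix.mul_assoc,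
    Matrix.trace_mul_comm]
  simp only [Matrix.mul_assoc]

theorem TS_ne_zero : D.TS ≠ 0 := fun h => D.T_ne_zero (by rw [h, Matrix.kronecker_zero])

/-- As the covariance matrices are invertible, the Frobenius norm vanishes only for `TS = 0`. -/
theorem traceProd_pos (i r : Fin D.a) : 0 < D.traceProd i r := by
  obtain ⟨B, C, hB, hC, h⟩ := D.exists_traceProd_eq i r
  rw [h]
  refine lt_of_le_of_ne (Matrix.posSemidef_conjTranspose_mul_self _).trace_nonneg fun h0 =>
    D.TS_ne_zero ?_
  have hG := Matrix.trace_conjTranspose_mul_self_eq_zero_iff.1 h0.symm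
  have hz : D.cov i * D.TS * D.cov r = 0 := by
    rw [hB, hC, show Bᴴ * B * D.TS * (Cᴴ * C) = Bᴴ * (B * D.TS * Cᴴ) * C by
      simp only [Matrix.mul_assoc], hG]
    simp
  have h1 := (D.cov_posDef r).isUnit.mul_left_eq_zero.1 hz
  exact (D.cov_posDef i).isUnit.mul_right_eq_zero.1 h1

theorem TW_ne_zero : D.TW ≠ 0 := fun h => D.T_ne_zero (by rw [h, Matrix.zero_kronecker])

theorem trace_T_mul_V_sq_pos (hn : ∀ i, 0 < D.n i) : 0 < (D.T * D.V * (D.T * D.V)).trace := by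
  have h0 : ∀ i r, 0 ≤ (D.N : ℝ) ^ 2 / (D.n i * D.n r) * D.TW i r ^ 2 * D.traceProd i r :=
    fun i r => mul_nonneg (by positivity) (D.traceProd_pos i r).le
  obtain ⟨i, r, hir⟩ : ∃ i r, D.TW i r ≠ 0 := by
    by_contra! h
    exact D.TW_ne_zero (by ext i r; simp [h])
  rw [trace_T_mul_V_sq]
  refine Finset.sum_pos' (fun i _ => Finset.sum_nonneg fun r _ => h0 i r) ⟨i, Finset.mem_univ _, ?_⟩
  refine Finset.sum_pos' (fun r _ => h0 i r) ⟨r, Finset.mem_univ _, ?_⟩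
  have h1 : (0 : ℝ) < D.n i := by exact_mod_cast hn i
  have h2 : (0 : ℝ) < D.n r := by exact_mod_cast hn r
  have hN : (0 : ℝ) < D.N := by
    have : 0 < D.N := Finset.sum_pos' (fun i _ => (hn i).le) ⟨i, Finset.mem_univ _, hn i⟩
    exact_mod_cast this
  have := D.traceProd_pos i r
  positivity

end Matrices

section NullForm

variable {D : SplitPlotDesign} {Ω : Type*} [MeasurableSpace Ω]
  {X : (i : Fin D.a) → Fin (D.n i) → Ω → EuclideanSpace ℝ (Fin D.d)} {P : Measure Ω}

/-- Under the null hypothesis, `Q_N` does not change when the group means are centred. -/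
theorem Q_eq_centeredMean (h₀ : D.NullHypothesis) (x : D.Data) :
    D.Q x = D.centeredMean x ⬝ᵥ D.T *ᵥ D.centeredMean x := by
  have hc : D.centeredMean x = √D.N • (D.stack (D.groupMean x) - D.stack D.mean) := by
    ext p
    simp [centeredMean, stack]
  have h₀' : D.T *ᵥ D.stack D.mean = 0 := h₀
  have h1 : D.stack D.mean ⬝ᵥ D.T *ᵥ D.stack (D.groupMean x) = 0 := by
    rw [Matrix.dotProduct_mulVec, ← Matrix.mulVec_transpose, D.T_symm.eq, h₀', zero_dotProduct]
  rw [hc, Matrix.mulVec_smul, Matrix.mulVec_sub, h₀', sub_zero, smul_dotProduct, dotProduct_smul,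
    sub_dotProduct, h1, sub_zero, smul_smul, Real.mul_self_sqrt (by positivity), smul_eq_mul, Q]

theorem IsModel.integral_Q (hX : D.IsModel X P) (h₀ : D.NullHypothesis) (hn : ∀ i, 0 < D.n i) :
    ∫ ω, D.Q (fun i j => X i j ω) ∂P = (D.T * D.V).trace := by
  have hZ := hX.isCenteredGaussian_centeredMean hn
  simp_rw [Q_eq_centeredMean h₀]
  exact integral_quadraticForm hZ hZ.posSemidef D.T_symm D.T_idem

theorem IsModel.variance_Q (hX : D.IsModel X P) (h₀ : D.NullHypothesis) (hn : ∀ i, 0 < D.n i) :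
    Var[fun ω => D.Q fun i j => X i j ω; P] = 2 * (D.T * D.V * (D.T * D.V)).trace := by
  have hZ := hX.isCenteredGaussian_centeredMean hn
  simp_rw [Q_eq_centeredMean h₀]
  exact variance_quadraticForm hZ hZ.posSemidef D.T_symm D.T_idem

theorem IsModel.memLp_two_Q (hX : D.IsModel X P) (h₀ : D.NullHypothesis) (hn : ∀ i, 0 < D.n i) :
    MemLp (fun ω => D.Q fun i j => X i j ω) 2 P := by
  simp_rw [Q_eq_centeredMean h₀]
  exact memLp_two_quadraticForm (hX.isCenteredGaussian_centeredMean hn) _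

theorem prod_range_eigenvalue (D : SplitPlotDesign) {M : Type*} [CommMonoid M] (f : ℝ → M) :
    ∏ s ∈ Finset.range (D.a * D.d), f (D.eigenvalue s) =
      ∏ p, f (D.isHermitian_TVT.eigenvalues p) := by
  have hc : Fintype.card (Fin D.a × Fin D.d) = D.a * D.d := by simp
  rw [← hc, Finset.prod_range]
  -- `eigenvalues` is `eigenvalues₀` reindexed along this equivalence
  rw [← (Fintype.equivOfCardEq
    (Fintype.card_fin (Fintype.card (Fin D.a × Fin D.d)))).symm.prod_comp]
  refine Finset.prod_congr rfl fun p _ => ?_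
  rw [eigenvalue, dif_pos (Fin.isLt _)]
  rfl

theorem sum_sq_eigenvalue (D : SplitPlotDesign) :
    ∑ s ∈ Finset.range (D.a * D.d), D.eigenvalue s ^ 2 = (D.T * D.V * (D.T * D.V)).trace := by
  rw [← trace_sq_projection_sandwich D.T_idem, ← sum_sq_eigenvalues_eq_trace D.isHermitian_TVT]
  -- the sum is a product in `Multiplicative ℝ`
  exact D.prod_range_eigenvalue (M := Multiplicative ℝ) fun x => Multiplicative.ofAdd (x ^ 2)

/-- In distribution, `W̃` is the sum of independent standardized chi-squared variables weighted by
the standardized eigenvalues. -/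
theorem IsModel.charFun_map_Wtilde (hX : D.IsModel X P) (h₀ : D.NullHypothesis)
    (hn : ∀ i, 0 < D.n i) (t : ℝ) :
    charFun (P.map (D.Wtilde X P)) t =
      ∏ s ∈ Finset.range (D.a * D.d), charFun stdChiSq (D.beta s * t) := by
  have hZ := hX.isCenteredGaussian_centeredMean hn
  have h := charFun_standardized_quadraticForm hZ hZ.posSemidef D.T_symm D.T_idem
    D.isHermitian_TVT t
  simp only [beta, sum_sq_eigenvalue]
  rw [D.prod_range_eigenvalue fun x =>
    charFun stdChiSq (x / √(D.T * D.V * (D.T * D.V)).trace * t), ← h]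
  congr 2
  ext ω
  rw [Wtilde, hX.integral_Q h₀ hn, hX.variance_Q h₀ hn, Q_eq_centeredMean h₀]

theorem sum_sq_beta (D : SplitPlotDesign) (hn : ∀ i, 0 < D.n i) :
    ∑ s ∈ Finset.range (D.a * D.d), D.beta s ^ 2 = 1 := by
  have h := D.trace_T_mul_V_sq_pos hn
  simp only [beta, div_pow, ← Finset.sum_div, sum_sq_eigenvalue]
  rw [Real.sq_sqrt h.le, div_self h.ne']

theorem beta_eq_zero (D : SplitPlotDesign) {s : ℕ} (hs : D.a * D.d ≤ s) : D.beta s = 0 := by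
  rw [beta, eigenvalue, dif_neg (by simpa using hs), zero_div]

theorem V_posSemidef (D : SplitPlotDesign) : D.V.PosSemidef := by
  refine Matrix.PosSemidef.of_dotProduct_mulVec_nonneg ?_ fun x => ?_
  · ext p q
    have h := (D.cov_posDef p.1).isHermitian.apply p.2 q.2
    rw [star_trivial] at h
    rw [Matrix.conjTranspose_apply, star_trivial, V_apply, V_apply]
    by_cases hpq : p.1 = q.1
    · rw [if_pos hpq, if_pos hpq.symm, ← hpq, h]
    · rw [if_neg hpq, if_neg (Ne.symm hpq)]
  · have h : star x ⬝ᵥ D.V *ᵥ x = ∑ i, (D.N : ℝ) / D.n i *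
        ((fun t => x (i, t)) ⬝ᵥ D.cov i *ᵥ fun t => x (i, t)) := by
      simp only [star_trivial, dotProduct, Matrix.mulVec, Fintype.sum_prod_type, V_apply]
      refine Finset.sum_congr rfl fun i _ => ?_
      rw [Finset.mul_sum]
      refine Finset.sum_congr rfl fun t _ => ?_
      rw [Finset.sum_eq_single i (fun r _ hr => by simp [hr.symm]) (by simp)]
      simp only [if_true, Finset.mul_sum]
      exact Finset.sum_congr rfl fun t' _ => by ring
    rw [h]
    refine Finset.sum_nonneg fun i _ => mul_nonneg (by positivity) ?_
    simpa using (D.cov_posDef i).posSemidef.dotProduct_mulVec_nonneg fun t => x (i, t)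

theorem eigenvalue_nonneg (D : SplitPlotDesign) (s : ℕ) : 0 ≤ D.eigenvalue s := by
  rw [eigenvalue]
  split_ifs with h
  · have hpos : (D.T * D.V * D.T).PosSemidef := by
      have h := D.V_posSemidef.mul_mul_conjTranspose_same D.T
      rwa [Matrix.conjTranspose_eq_transpose_of_trivial, D.T_symm.eq] at h
    have := hpos.eigenvalues_nonneg (Fintype.equivOfCardEq (Fintype.card_fin _) ⟨s, h⟩)
    rwa [Matrix.IsHermitian.eigenvalues, Equiv.symm_apply_apply] at this
  · exact le_rfl

theorem beta_nonneg (D : SplitPlotDesign) (s : ℕ) : 0 ≤ D.beta s :=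
  div_nonneg (D.eigenvalue_nonneg s) (Real.sqrt_nonneg _)

theorem beta_le_beta_zero (D : SplitPlotDesign) (s : ℕ) : D.beta s ≤ D.beta 0 := by
  refine div_le_div_of_nonneg_right ?_ (Real.sqrt_nonneg _)
  by_cases hs : s < Fintype.card (Fin D.a × Fin D.d)
  · rw [eigenvalue, dif_pos hs, eigenvalue, dif_pos (by omega)]
    exact D.isHermitian_TVT.eigenvalues₀_antitone (Fin.mk_le_mk.2 (Nat.zero_le s))
  · rw [eigenvalue, dif_neg hs]
    exact D.eigenvalue_nonneg 0

end NullForm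

/-! ### The estimators as averages and the estimator of the mean -/

section Estimators

variable {D : SplitPlotDesign} {Ω : Type*} [MeasurableSpace Ω]
  {X : (i : Fin D.a) → Fin (D.n i) → Ω → EuclideanSpace ℝ (Fin D.d)} {P : Measure Ω}

theorem measurable_bilin {α : Type*} [MeasurableSpace α] {u v : α → EuclideanSpace ℝ (Fin D.d)}
    (hu : Measurable u) (hv : Measurable v) : Measurable fun x => D.bilin (u x) (v x) := by
  simp only [bilin, dotProduct, Matrix.mulVec]
  fun_prop

/-- Functions of the data that use disjoint sets of observations are independent. -/
theorem IsModel.indepFun (hX : D.IsModel X P) {f g : D.Data → ℝ} (hf : Measurable f)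
    (hg : Measurable g) {S T : Finset ((i : Fin D.a) × Fin (D.n i))} (hST : Disjoint S T)
    (hfS : ∀ x y : D.Data, (∀ p ∈ S, x p.1 p.2 = y p.1 p.2) → f x = f y)
    (hgT : ∀ x y : D.Data, (∀ p ∈ T, x p.1 p.2 = y p.1 p.2) → g x = g y) :
    IndepFun (fun ω => f fun i j => X i j ω) (fun ω => g fun i j => X i j ω) P := by
  have hc : Measurable fun (z : (i : Fin D.a) × Fin (D.n i) → EuclideanSpace ℝ (Fin D.d)) i j =>
      z ⟨i, j⟩ := by fun_prop
  exact indepFun_of_dependsOn (f := fun z => f fun i j => z ⟨i, j⟩)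
    (g := fun z => g fun i j => z ⟨i, j⟩) (fun _ => 0) hX.indep
    (fun p => hX.aemeasurable p.1 p.2) (hf.comp hc) (hg.comp hc)
    (fun x y h => hfS _ _ fun p hp => h p hp) (fun x y h => hgT _ _ fun p hp => h p hp) hST

theorem A1_eq (D : SplitPlotDesign) (x : D.Data) (i : Fin D.a) :
    D.A1 x i = 1 / (2 * ((orderedPairs (D.n i)).card : ℝ)) *
      ∑ p ∈ orderedPairs (D.n i), D.bilin (x i p.1 - x i p.2) (x i p.1 - x i p.2) := by
  rw [A1, card_orderedPairs, orderedPairs, Finset.sum_filter, Fintype.sum_prod_type]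
  simp only [Finset.sum_filter]

theorem A2_eq (D : SplitPlotDesign) (x : D.Data) (i r : Fin D.a) :
    D.A2 x i r = 1 / (4 * ((orderedPairs (D.n i) ×ˢ orderedPairs (D.n r)).card : ℝ)) *
      ∑ q ∈ orderedPairs (D.n i) ×ˢ orderedPairs (D.n r),
        D.bilin (x i q.1.1 - x i q.1.2) (x r q.2.1 - x r q.2.2) ^ 2 := by
  rw [A2, Finset.card_product, card_orderedPairs, card_orderedPairs, Finset.sum_product]
  simp only [orderedPairs, Finset.sum_filter, Fintype.sum_prod_type]
  push_cast
  rw [mul_assoc]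

theorem A3_eq (D : SplitPlotDesign) (x : D.Data) (i : Fin D.a) :
    D.A3 x i = 1 / (4 * ((disjointOrderedPairs (D.n i)).card : ℝ)) *
      ∑ q ∈ disjointOrderedPairs (D.n i),
        D.bilin (x i q.1.1 - x i q.1.2) (x i q.2.1 - x i q.2.2) ^ 2 := by
  rw [A3, card_disjointOrderedPairs, disjointOrderedPairs, Finset.sum_filter, Finset.sum_product]
  simp only [orderedPairs, Finset.sum_filter, Fintype.sum_prod_type]
  push_cast
  rw [mul_assoc]
  congr 1
  refine Finset.sum_congr rfl fun l₁ _ => Finset.sum_congr rfl fun l₂ _ => ?_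
  split_ifs with hl
  · rw [Finset.sum_comm]
    refine Finset.sum_congr rfl fun k₂ _ => ?_
    split_ifs with hk
    · refine Finset.sum_congr rfl fun k₁ _ => ?_
      by_cases h : k₂ < k₁ <;> simp [h, hk.1, hk.2]
    · refine (Finset.sum_eq_zero fun k₁ _ => ?_).symm
      split_ifs with h₁ h₂
      exacts [absurd h₂.2.2 hk, rfl, rfl]
  · rfl

/-- Mean and variance of the summands of `A_{i,1}`. -/
theorem IsModel.bilin_self_moments (hX : D.IsModel X P) (i : Fin D.a) {l₁ l₂ : Fin (D.n i)}
    (hl : l₁ ≠ l₂) :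
    MemLp (fun ω => D.bilin (X i l₁ ω - X i l₂ ω) (X i l₁ ω - X i l₂ ω)) 2 P ∧
      ∫ ω, D.bilin (X i l₁ ω - X i l₂ ω) (X i l₁ ω - X i l₂ ω) ∂P =
        2 * (D.TS * D.cov i).trace ∧
      Var[fun ω => D.bilin (X i l₁ ω - X i l₂ ω) (X i l₁ ω - X i l₂ ω); P] =
        8 * D.traceProd i i := by
  have hu := hX.isCenteredGaussian_sub i hl
  refine ⟨memLp_two_quadraticForm hu D.TS, ?_, ?_⟩
  · rw [show (∫ ω, D.bilin (X i l₁ ω - X i l₂ ω) (X i l₁ ω - X i l₂ ω) ∂P) = _ from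
      integral_quadraticForm hu hu.posSemidef D.TS_symm D.TS_idem, Matrix.mul_smul,
      Matrix.trace_smul, smul_eq_mul]
  · rw [show Var[fun ω => D.bilin (X i l₁ ω - X i l₂ ω) (X i l₁ ω - X i l₂ ω); P] = _ from
      variance_quadraticForm hu hu.posSemidef D.TS_symm D.TS_idem, traceProd]
    simp only [Matrix.mul_smul, Matrix.smul_mul, Matrix.trace_smul, smul_eq_mul]
    ring

theorem sampleIndex_injective (i : Fin D.a) :
    Function.Injective fun l : Fin (D.n i) => (⟨i, l⟩ : (i : Fin D.a) × Fin (D.n i)) :=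
  sigma_mk_injective (β := fun i => Fin (D.n i))

/-- `A_{i,1}` is unbiased, and its variance is small relative to `tr ((TS Σ i)²)`: a summand shares
an observation with at most `4 n i` of the `n i (n i - 1) / 2` summands. -/
theorem IsModel.A1_moments (hX : D.IsModel X P) (i : Fin D.a) (hn : 2 ≤ D.n i) :
    MemLp (fun ω => D.A1 (fun i j => X i j ω) i) 2 P ∧
      ∫ ω, D.A1 (fun i j => X i j ω) i ∂P = (D.TS * D.cov i).trace ∧
      Var[fun ω => D.A1 (fun i j => X i j ω) i; P] ≤ 32 / D.n i * D.traceProd i i := by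
  have := hX.indep.isProbabilityMeasure
  have hm := fun (p : Fin (D.n i) × Fin (D.n i)) (hp : p ∈ orderedPairs (D.n i)) =>
    hX.bilin_self_moments i (Finset.mem_filter.1 hp).2.ne'
  have hn0 : (0 : ℝ) < D.n i := by exact_mod_cast (show 0 < D.n i by omega)
  have hcard := sq_le_card_orderedPairs hn
  have hC : (0 : ℝ) < (orderedPairs (D.n i)).card := by
    have := pow_pos hn0 2
    linarith
  have hτ := (D.traceProd_pos i i).le
  simp only [A1_eq]
  refine ⟨(memLp_finsetSum _ fun p hp => (hm p hp).1).const_mul _, ?_, ?_⟩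
  · rw [integral_const_mul, integral_finsetSum _ fun p hp => (hm p hp).1.integrable (by norm_num),
      Finset.sum_congr rfl fun p hp => (hm p hp).2.1, Finset.sum_const, nsmul_eq_mul]
    field_simp
  · have hv := variance_sum_le_of_indepFun (P := P) (orderedPairs (D.n i))
      (h := fun p ω => D.bilin (X i p.1 ω - X i p.2 ω) (X i p.1 ω - X i p.2 ω))
      (fun p hp => (hm p hp).1) (K := 8 * D.traceProd i i) (fun p hp => (hm p hp).2.2.le)
      (fun p q => ¬Disjoint ({⟨i, p.1⟩, ⟨i, p.2⟩} : Finset ((i : Fin D.a) × Fin (D.n i)))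
        {⟨i, q.1⟩, ⟨i, q.2⟩})
      (fun p _ q _ hpq => hX.indepFun
        (f := fun x => D.bilin (x i p.1 - x i p.2) (x i p.1 - x i p.2))
        (g := fun x => D.bilin (x i q.1 - x i q.2) (x i q.1 - x i q.2))
        (measurable_bilin (by fun_prop) (by fun_prop))
        (measurable_bilin (by fun_prop) (by fun_prop)) (not_not.1 hpq)
        (fun x y h => by
          simp only [Finset.mem_insert, Finset.mem_singleton, forall_eq_or_imp, forall_eq] at h
          rw [h.1, h.2])
        (fun x y h => by
          simp only [Finset.mem_insert, Finset.mem_singleton, forall_eq_or_imp, forall_eq] at h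
          rw [h.1, h.2]))
      (B := 4 * D.n i) (by positivity) (fun p _ => by
        have h1 := card_filter_not_disjoint_pair_le (sampleIndex_injective i)
          ({⟨i, p.1⟩, ⟨i, p.2⟩} : Finset ((i : Fin D.a) × Fin (D.n i)))
        have h2 : ({⟨i, p.1⟩, ⟨i, p.2⟩} : Finset ((i : Fin D.a) × Fin (D.n i))).card ≤ 2 :=
          Finset.card_le_two
        have h3 := (Finset.card_le_card (Finset.filter_subset_filter _
          (Finset.subset_univ (orderedPairs (D.n i))))).trans (h1.trans
            (Nat.mul_le_mul_right _ h2))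
        calc _ ≤ ((2 * (2 * D.n i) : ℕ) : ℝ) := by exact_mod_cast h3
          _ = 4 * D.n i := by push_cast; ring)
    rw [variance_const_mul]
    calc _ ≤ (1 / (2 * ((orderedPairs (D.n i)).card : ℝ))) ^ 2 *
          ((orderedPairs (D.n i)).card * (4 * D.n i) * (8 * D.traceProd i i)) := by gcongr
      _ = 8 * D.n i / (orderedPairs (D.n i)).card * D.traceProd i i := by
          field_simp
          ring
      _ ≤ 32 / D.n i * D.traceProd i i := by
          refine mul_le_mul_of_nonneg_right ?_ hτ
          rw [div_le_div_iff₀ hC hn0]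
          nlinarith

/-- Moments of the estimator `∑ i, (N / n i) (TW)_{ii} A_{i,1}`: the estimators of different groups
are independent, so that its variance only involves the diagonal terms of `tr ((T V_N)²)`. -/
theorem IsModel.meanEst_moments (hX : D.IsModel X P) {m : ℕ} (hm : 2 ≤ m)
    (hn : ∀ i, m ≤ D.n i) :
    MemLp (fun ω => D.meanEst fun i j => X i j ω) 2 P ∧
      ∫ ω, D.meanEst (fun i j => X i j ω) ∂P = (D.T * D.V).trace ∧
      Var[fun ω => D.meanEst fun i j => X i j ω; P] ≤
        32 / m * (D.T * D.V * (D.T * D.V)).trace := by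
  have := hX.indep.isProbabilityMeasure
  have hA := fun i => hX.A1_moments i (hm.trans (hn i))
  have hm0 : (0 : ℝ) < m := by exact_mod_cast (show 0 < m by omega)
  have hL : ∀ i, MemLp (fun ω => (D.N : ℝ) / D.n i * D.TW i i * D.A1 (fun i j => X i j ω) i) 2 P :=
    fun i => (hA i).1.const_mul _
  refine ⟨memLp_finsetSum _ fun i _ => hL i, ?_, ?_⟩
  · simp only [meanEst]
    rw [integral_finsetSum _ fun i _ => (hL i).integrable (by norm_num), trace_T_mul_V]
    exact Finset.sum_congr rfl fun i _ => by rw [integral_const_mul, (hA i).2.1]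
  · have hmeas : ∀ i, Measurable fun x : D.Data => (D.N : ℝ) / D.n i * D.TW i i * D.A1 x i :=
      fun i => by
        simp only [A1_eq]
        refine Measurable.const_mul (Measurable.const_mul (Finset.measurable_fun_sum _ fun p _ =>
          measurable_bilin (by fun_prop) (by fun_prop)) _) _
    have hdep : ∀ i (x y : D.Data), (∀ p ∈ Finset.univ.filter
        (fun p : (i : Fin D.a) × Fin (D.n i) => p.1 = i), x p.1 p.2 = y p.1 p.2) →
        (D.N : ℝ) / D.n i * D.TW i i * D.A1 x i = (D.N : ℝ) / D.n i * D.TW i i * D.A1 y i := by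
      intro i x y h
      have : ∀ l, x i l = y i l := fun l => h ⟨i, l⟩ (by simp)
      simp only [A1_eq, this]
    have hv := IndepFun.variance_sum (μ := P) (s := Finset.univ)
      (X := fun i ω => (D.N : ℝ) / D.n i * D.TW i i * D.A1 (fun i j => X i j ω) i)
      (fun i _ => hL i) (fun i _ r _ hir => hX.indepFun (hmeas i) (hmeas r)
        (Finset.disjoint_filter.2 fun p _ h h' => hir (h.symm.trans h')) (hdep i) (hdep r))
    have hs : (∑ i, fun ω => (D.N : ℝ) / D.n i * D.TW i i * D.A1 (fun i j => X i j ω) i) =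
        fun ω => D.meanEst fun i j => X i j ω := by
      ext ω; simp [meanEst]
    rw [hs] at hv
    rw [hv, trace_T_mul_V_sq, Finset.mul_sum]
    refine Finset.sum_le_sum fun i _ => ?_
    have h0 : ∀ r, 0 ≤ (D.N : ℝ) ^ 2 / (D.n i * D.n r) * D.TW i r ^ 2 * D.traceProd i r :=
      fun r => mul_nonneg (by positivity) (D.traceProd_pos i r).le
    have hni : (m : ℝ) ≤ D.n i := by exact_mod_cast hn i
    have hτ := (D.traceProd_pos i i).le
    calc _ ≤ ((D.N : ℝ) / D.n i * D.TW i i) ^ 2 * (32 / m * D.traceProd i i) := by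
          rw [variance_const_mul]
          refine mul_le_mul_of_nonneg_left ((hA i).2.2.trans ?_) (sq_nonneg _)
          gcongr
      _ = 32 / m * ((D.N : ℝ) ^ 2 / (D.n i * D.n i) * D.TW i i ^ 2 * D.traceProd i i) := by ring
      _ ≤ _ := by
          refine mul_le_mul_of_nonneg_left ?_ (by positivity)
          exact Finset.single_le_sum (f := fun r => (D.N : ℝ) ^ 2 / (D.n i * D.n r) *
            D.TW i r ^ 2 * D.traceProd i r) (fun r _ => h0 r) (Finset.mem_univ i)

end Estimators

/-! ### The estimator of the variance -/

section VarianceEstimator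

variable {D : SplitPlotDesign} {Ω : Type*} [MeasurableSpace Ω]
  {X : (i : Fin D.a) → Fin (D.n i) → Ω → EuclideanSpace ℝ (Fin D.d)} {P : Measure Ω}

/-- Moments of the summands of `A_{i,r,2}` and `A_{i,3}`. -/
theorem IsModel.bilin_sq_moments (hX : D.IsModel X P) {i r : Fin D.a}
    {q : (Fin (D.n i) × Fin (D.n i)) × (Fin (D.n r) × Fin (D.n r))}
    (hl : q.1.1 ≠ q.1.2) (hk : q.2.1 ≠ q.2.2)
    (hq : Disjoint ({⟨i, q.1.1⟩, ⟨i, q.1.2⟩} : Finset ((i : Fin D.a) × Fin (D.n i)))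
      {⟨r, q.2.1⟩, ⟨r, q.2.2⟩}) :
    MemLp (fun ω => D.bilin (X i q.1.1 ω - X i q.1.2 ω) (X r q.2.1 ω - X r q.2.2 ω) ^ 2) 2 P ∧
      ∫ ω, D.bilin (X i q.1.1 ω - X i q.1.2 ω) (X r q.2.1 ω - X r q.2.2 ω) ^ 2 ∂P =
        4 * D.traceProd i r ∧
      Var[fun ω => D.bilin (X i q.1.1 ω - X i q.1.2 ω) (X r q.2.1 ω - X r q.2.2 ω) ^ 2; P] ≤
        144 * D.traceProd i r ^ 2 := by
  have := hX.indep.isProbabilityMeasure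
  have hu := hX.isCenteredGaussian_sub i hl
  have hv := hX.isCenteredGaussian_sub r hk
  simp only [Finset.disjoint_insert_left, Finset.disjoint_singleton_left, Finset.mem_insert,
    Finset.mem_singleton, not_or] at hq
  have huv := hX.indepFun_sub_sub hq.1.1 hq.1.2 hq.2.1 hq.2.2
  obtain ⟨h2, h4⟩ := bilinear_moments hu hv huv hu.posSemidef hv.posSemidef D.TS_symm
  have hL := memLp_four_bilinear hu hv huv D.TS
  have htr : (D.TS * (2 : ℝ) • D.cov i * (D.TS * (2 : ℝ) • D.cov r)).trace =
      4 * D.traceProd i r := by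
    simp only [traceProd, Matrix.mul_smul, Matrix.smul_mul, Matrix.trace_smul, smul_eq_mul]
    ring
  rw [htr] at h2 h4
  have hL2 : MemLp (fun ω => D.bilin (X i q.1.1 ω - X i q.1.2 ω)
      (X r q.2.1 ω - X r q.2.2 ω) ^ 2) 2 P := by
    refine (memLp_two_iff_integrable_sq (hL.aestronglyMeasurable.pow 2)).2 ?_
    have := hL.integrable_norm_pow (by norm_num)
    refine this.congr (ae_of_all _ fun ω => ?_)
    simp only [Real.norm_eq_abs]
    norm_num
    rw [Even.pow_abs (by decide)]
    ring
  refine ⟨hL2, h2, ?_⟩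
  calc _ ≤ ∫ ω, (D.bilin (X i q.1.1 ω - X i q.1.2 ω) (X r q.2.1 ω - X r q.2.2 ω) ^ 2) ^ 2 ∂P :=
        variance_le_expectation_sq hL2.aestronglyMeasurable
    _ ≤ 9 * (4 * D.traceProd i r) ^ 2 := by
        simpa only [← pow_mul, bilin, Nat.reduceMul] using h4
    _ = _ := by ring

/-- The average of the squared kernel over a set of quadruples of observations estimates
`tr (TS Σ i TS Σ r)` with a relative error of order `1 / √m`: a quadruple shares an observation
with at most `8 n_i n_r (n_i + n_r)` of the at least `n_i² n_r² / 32` ones. -/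
theorem IsModel.average_bilin_sq (hX : D.IsModel X P) {m : ℕ} (hm : 2 ≤ m)
    (hn : ∀ i, m ≤ D.n i) {i r : Fin D.a}
    (I : Finset ((Fin (D.n i) × Fin (D.n i)) × (Fin (D.n r) × Fin (D.n r))))
    (hI : ∀ q ∈ I, q.1.1 ≠ q.1.2 ∧ q.2.1 ≠ q.2.2 ∧
      Disjoint ({⟨i, q.1.1⟩, ⟨i, q.1.2⟩} : Finset ((i : Fin D.a) × Fin (D.n i)))
        {⟨r, q.2.1⟩, ⟨r, q.2.2⟩})
    (hcard : (D.n i : ℝ) ^ 2 * D.n r ^ 2 ≤ 32 * I.card) :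
    MemLp (fun ω => 1 / (4 * (I.card : ℝ)) * ∑ q ∈ I,
        D.bilin (X i q.1.1 ω - X i q.1.2 ω) (X r q.2.1 ω - X r q.2.2 ω) ^ 2) 2 P ∧
      ∫ ω, |1 / (4 * (I.card : ℝ)) * ∑ q ∈ I,
        D.bilin (X i q.1.1 ω - X i q.1.2 ω) (X r q.2.1 ω - X r q.2.2 ω) ^ 2
          - D.traceProd i r| ∂P ≤ √(4608 / m) * D.traceProd i r := by
  have := hX.indep.isProbabilityMeasure
  have hq := fun q (hq : q ∈ I) => hX.bilin_sq_moments (hI q hq).1 (hI q hq).2.1 (hI q hq).2.2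
  have hm0 : (0 : ℝ) < m := by exact_mod_cast (show 0 < m by omega)
  have hmi : (m : ℝ) ≤ D.n i := by exact_mod_cast hn i
  have hmr : (m : ℝ) ≤ D.n r := by exact_mod_cast hn r
  have hi0 := hm0.trans_le hmi
  have hr0 := hm0.trans_le hmr
  have hC : (0 : ℝ) < I.card := by
    have : 0 < (D.n i : ℝ) ^ 2 * D.n r ^ 2 := by positivity
    linarith
  have hτ := (D.traceProd_pos i r).le
  have hL : MemLp (fun ω => 1 / (4 * (I.card : ℝ)) * ∑ q ∈ I,
        D.bilin (X i q.1.1 ω - X i q.1.2 ω) (X r q.2.1 ω - X r q.2.2 ω) ^ 2) 2 P :=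
    (memLp_finsetSum _ fun q h => (hq q h).1).const_mul _
  refine ⟨hL, (integral_abs_sub_le_sqrt_variance hL ?_).trans ?_⟩
  · rw [integral_const_mul, integral_finsetSum _ fun q h => (hq q h).1.integrable (by norm_num),
      Finset.sum_congr rfl fun q h => (hq q h).2.1, Finset.sum_const, nsmul_eq_mul]
    field_simp
  · have hv := variance_sum_le_of_indepFun (P := P) I
      (h := fun q ω => D.bilin (X i q.1.1 ω - X i q.1.2 ω) (X r q.2.1 ω - X r q.2.2 ω) ^ 2)
      (fun q h => (hq q h).1) (K := 144 * D.traceProd i r ^ 2) (fun q h => (hq q h).2.2)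
      (fun p q => ¬Disjoint
        ({⟨i, p.1.1⟩, ⟨i, p.1.2⟩, ⟨r, p.2.1⟩, ⟨r, p.2.2⟩} :
          Finset ((i : Fin D.a) × Fin (D.n i)))
        {⟨i, q.1.1⟩, ⟨i, q.1.2⟩, ⟨r, q.2.1⟩, ⟨r, q.2.2⟩})
      (fun p _ q _ hpq => hX.indepFun
        (f := fun x => D.bilin (x i p.1.1 - x i p.1.2) (x r p.2.1 - x r p.2.2) ^ 2)
        (g := fun x => D.bilin (x i q.1.1 - x i q.1.2) (x r q.2.1 - x r q.2.2) ^ 2)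
        ((measurable_bilin (by fun_prop) (by fun_prop)).pow_const 2)
        ((measurable_bilin (by fun_prop) (by fun_prop)).pow_const 2) (not_not.1 hpq)
        (fun x y h => by
          simp only [Finset.mem_insert, Finset.mem_singleton, forall_eq_or_imp, forall_eq] at h
          rw [h.1, h.2.1, h.2.2.1, h.2.2.2])
        (fun x y h => by
          simp only [Finset.mem_insert, Finset.mem_singleton, forall_eq_or_imp, forall_eq] at h
          rw [h.1, h.2.1, h.2.2.1, h.2.2.2]))
      (B := 8 * D.n i * D.n r * (D.n i + D.n r)) (by positivity) (fun p _ => by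
        have h1 := card_filter_not_disjoint_quadruple_le (sampleIndex_injective i)
          (sampleIndex_injective r)
          ({⟨i, p.1.1⟩, ⟨i, p.1.2⟩, ⟨r, p.2.1⟩, ⟨r, p.2.2⟩} :
            Finset ((i : Fin D.a) × Fin (D.n i)))
        have h2 : ({⟨i, p.1.1⟩, ⟨i, p.1.2⟩, ⟨r, p.2.1⟩, ⟨r, p.2.2⟩} :
            Finset ((i : Fin D.a) × Fin (D.n i))).card ≤ 4 := Finset.card_le_four
        have h3 := (Finset.card_le_card (Finset.filter_subset_filter _
          (Finset.subset_univ I))).trans (h1.trans (add_le_add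
            (Nat.mul_le_mul_right _ (Nat.mul_le_mul_right _ h2))
            (Nat.mul_le_mul_left _ (Nat.mul_le_mul_right _ h2))))
        refine (Nat.cast_le (α := ℝ).2 h3).trans_eq ?_
        push_cast
        ring)
    rw [variance_const_mul]
    refine (Real.sqrt_le_sqrt (y := 4608 / m * D.traceProd i r ^ 2) ?_).trans_eq ?_
    · calc _ ≤ (1 / (4 * (I.card : ℝ))) ^ 2 * (I.card *
            (8 * D.n i * D.n r * (D.n i + D.n r)) * (144 * D.traceProd i r ^ 2)) := by gcongr
        _ = 72 * D.n i * D.n r * (D.n i + D.n r) / I.card * D.traceProd i r ^ 2 := by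
            field_simp
            ring
        _ ≤ 4608 / m * D.traceProd i r ^ 2 := by
            refine mul_le_mul_of_nonneg_right ?_ (sq_nonneg _)
            rw [div_le_div_iff₀ hC hm0]
            have h1 : (D.n i + D.n r) * (m : ℝ) ≤ 2 * (D.n i * D.n r) := by nlinarith
            have h2 := mul_le_mul_of_nonneg_left h1
              (show (0 : ℝ) ≤ 72 * D.n i * D.n r by positivity)
            linarith
    · rw [Real.sqrt_mul (by positivity), Real.sqrt_sq hτ]

theorem sum_sum_eq_diag_add_two_mul {n : ℕ} {f : Fin n → Fin n → ℝ} (hf : ∀ i r, f i r = f r i) :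
    ∑ i, ∑ r, f i r = ∑ i, f i i + 2 * ∑ i, ∑ r with r < i, f i r := by
  have h1 : ∀ i, ∑ r, f i r = f i i + ((∑ r with r < i, f i r) + ∑ r with i < r, f i r) := by
    intro i
    have : ∀ r, f i r = (if r = i then f i r else 0) +
        ((if r < i then f i r else 0) + if i < r then f i r else 0) := by
      intro r
      rcases lt_trichotomy r i with h | h | h
      · simp [h, h.ne, h.not_gt]
      · simp [h]
      · simp [h, h.ne', h.not_gt]
    rw [Finset.sum_congr rfl fun r _ => this r, Finset.sum_add_distrib, Finset.sum_add_distrib,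
      Finset.sum_filter, Finset.sum_filter]
    simp
  have h2 : ∑ i, ∑ r with i < r, f i r = ∑ i, ∑ r with r < i, f i r := by
    simp only [Finset.sum_filter]
    rw [Finset.sum_comm]
    exact Finset.sum_congr rfl fun i _ => Finset.sum_congr rfl fun r _ => by rw [hf]
  rw [Finset.sum_congr rfl fun i _ => h1 i, Finset.sum_add_distrib, Finset.sum_add_distrib, h2]
  ring

theorem IsModel.A2_error (hX : D.IsModel X P) {m : ℕ} (hm : 2 ≤ m) (hn : ∀ i, m ≤ D.n i)
    {i r : Fin D.a} (hir : i ≠ r) :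
    MemLp (fun ω => D.A2 (fun i j => X i j ω) i r) 2 P ∧
      ∫ ω, |D.A2 (fun i j => X i j ω) i r - D.traceProd i r| ∂P ≤
        √(4608 / m) * D.traceProd i r := by
  simp only [A2_eq]
  refine hX.average_bilin_sq hm hn _ (fun q hq => ?_) ?_
  · obtain ⟨h1, h2⟩ := Finset.mem_product.1 hq
    refine ⟨(Finset.mem_filter.1 h1).2.ne', (Finset.mem_filter.1 h2).2.ne', ?_⟩
    simp [hir.symm]
  · rw [Finset.card_product]
    push_cast
    have h1 := sq_le_card_orderedPairs (hm.trans (hn i))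
    have h2 := sq_le_card_orderedPairs (hm.trans (hn r))
    calc _ ≤ (4 * ((orderedPairs (D.n i)).card : ℝ)) * (4 * (orderedPairs (D.n r)).card) := by
          gcongr
      _ ≤ _ := by
          have : (0 : ℝ) ≤ (orderedPairs (D.n i)).card * (orderedPairs (D.n r)).card := by
            positivity
          linarith

theorem IsModel.A3_error (hX : D.IsModel X P) {m : ℕ} (hm : 6 ≤ m) (hn : ∀ i, m ≤ D.n i)
    (i : Fin D.a) :
    MemLp (fun ω => D.A3 (fun i j => X i j ω) i) 2 P ∧
      ∫ ω, |D.A3 (fun i j => X i j ω) i - D.traceProd i i| ∂P ≤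
        √(4608 / m) * D.traceProd i i := by
  simp only [A3_eq]
  refine hX.average_bilin_sq (by omega) hn _ (fun q hq => ?_) ?_
  · obtain ⟨h, h3, h4, h5, h6⟩ := Finset.mem_filter.1 hq
    obtain ⟨h1, h2⟩ := Finset.mem_product.1 h
    refine ⟨(Finset.mem_filter.1 h1).2.ne', (Finset.mem_filter.1 h2).2.ne', ?_⟩
    simp [h3, h4, h5, h6]
  · refine le_of_eq_of_le ?_ (pow_four_le_card_disjointOrderedPairs (hm.trans (hn i)))
    ring

/-- `A_4` estimates `tr ((T V_N)²)` with a relative error of order `1 / √m` in `L¹`: all terms of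
`tr ((T V_N)²)` are nonnegative and each of them is estimated with that relative error. -/
theorem IsModel.A4_error (hX : D.IsModel X P) {m : ℕ} (hm : 6 ≤ m) (hn : ∀ i, m ≤ D.n i) :
    Integrable (fun ω => D.A4 fun i j => X i j ω) P ∧
      ∫ ω, |D.A4 (fun i j => X i j ω) - (D.T * D.V * (D.T * D.V)).trace| ∂P ≤
        √(4608 / m) * (D.T * D.V * (D.T * D.V)).trace := by
  have := hX.indep.isProbabilityMeasure
  have h2 := fun i r (hir : i ≠ r) => hX.A2_error (by omega) hn hir
  have h3 := hX.A3_error hm hn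
  have hI2 : ∀ i r, r ∈ Finset.univ.filter (fun r => r < i) →
      Integrable (fun ω => (D.N : ℝ) ^ 2 / (D.n i * D.n r) * D.TW i r ^ 2 *
        D.A2 (fun i j => X i j ω) i r) P := fun i r hr =>
    ((h2 i r (Finset.mem_filter.1 hr).2.ne').1.integrable (by norm_num)).const_mul _
  have hI3 : ∀ i, Integrable (fun ω => ((D.N : ℝ) / D.n i) ^ 2 * D.TW i i ^ 2 *
      D.A3 (fun i j => X i j ω) i) P := fun i =>
    ((h3 i).1.integrable (by norm_num)).const_mul _
  have hA4 : Integrable (fun ω => D.A4 fun i j => X i j ω) P :=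
    (integrable_finsetSum _ fun i _ => hI3 i).add ((integrable_finsetSum _ fun i _ =>
      integrable_finsetSum _ fun r hr => hI2 i r hr).const_mul 2)
  refine ⟨hA4, ?_⟩
  have hsym : ∀ i r, (D.N : ℝ) ^ 2 / (D.n i * D.n r) * D.TW i r ^ 2 * D.traceProd i r =
      (D.N : ℝ) ^ 2 / (D.n r * D.n i) * D.TW r i ^ 2 * D.traceProd r i := fun i r => by
    rw [D.traceProd_comm i r, D.TW_symm.apply i r, mul_comm (D.n i : ℝ)]
  rw [D.trace_T_mul_V_sq, sum_sum_eq_diag_add_two_mul hsym]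
  have hc : ∀ i r, 0 ≤ (D.N : ℝ) ^ 2 / (D.n i * D.n r) * D.TW i r ^ 2 := fun i r => by positivity
  have hD2 : ∀ i r, r ∈ Finset.univ.filter (fun r => r < i) →
      Integrable (fun ω => (D.N : ℝ) ^ 2 / (D.n i * D.n r) * D.TW i r ^ 2 *
        |D.A2 (fun i j => X i j ω) i r - D.traceProd i r|) P := fun i r hr =>
    (((h2 i r (Finset.mem_filter.1 hr).2.ne').1.integrable (by norm_num)).sub
      (integrable_const _)).abs.const_mul _
  have hD3 : ∀ i, Integrable (fun ω => (D.N : ℝ) ^ 2 / (D.n i * D.n i) * D.TW i i ^ 2 *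
      |D.A3 (fun i j => X i j ω) i - D.traceProd i i|) P := fun i =>
    (((h3 i).1.integrable (by norm_num)).sub (integrable_const _)).abs.const_mul _
  have hS3 := integrable_finsetSum Finset.univ fun i _ => hD3 i
  have hS2 := (integrable_finsetSum Finset.univ fun i _ =>
      integrable_finsetSum _ fun r hr => hD2 i r hr).const_mul 2
  calc _ ≤ ∫ ω, (∑ i, (D.N : ℝ) ^ 2 / (D.n i * D.n i) * D.TW i i ^ 2 *
          |D.A3 (fun i j => X i j ω) i - D.traceProd i i| +
        2 * ∑ i, ∑ r with r < i, (D.N : ℝ) ^ 2 / (D.n i * D.n r) * D.TW i r ^ 2 *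
          |D.A2 (fun i j => X i j ω) i r - D.traceProd i r|) ∂P := by
        refine integral_mono (hA4.sub (integrable_const _)).abs (hS3.add hS2) fun ω => ?_
        have e : D.A4 (fun i j => X i j ω) - (∑ i, (D.N : ℝ) ^ 2 / (D.n i * D.n i) *
              D.TW i i ^ 2 * D.traceProd i i + 2 * ∑ i, ∑ r with r < i,
              (D.N : ℝ) ^ 2 / (D.n i * D.n r) * D.TW i r ^ 2 * D.traceProd i r) =
            ∑ i, (D.N : ℝ) ^ 2 / (D.n i * D.n i) * D.TW i i ^ 2 *
              (D.A3 (fun i j => X i j ω) i - D.traceProd i i) +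
            2 * ∑ i, ∑ r with r < i, (D.N : ℝ) ^ 2 / (D.n i * D.n r) * D.TW i r ^ 2 *
              (D.A2 (fun i j => X i j ω) i r - D.traceProd i r) := by
          simp only [A4, mul_sub, Finset.sum_sub_distrib, div_pow, ← sq]
          ring
        simp only [e]
        refine (abs_add_le _ _).trans (add_le_add ?_ ?_)
        · refine (Finset.abs_sum_le_sum_abs _ _).trans_eq (Finset.sum_congr rfl fun i _ => ?_)
          rw [abs_mul, abs_of_nonneg (hc i i)]
        · rw [abs_mul, abs_two]
          refine mul_le_mul_of_nonneg_left ((Finset.abs_sum_le_sum_abs _ _).trans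
            (Finset.sum_le_sum fun i _ => (Finset.abs_sum_le_sum_abs _ _).trans_eq
              (Finset.sum_congr rfl fun r _ => ?_))) zero_le_two
          rw [abs_mul, abs_of_nonneg (hc i r)]
    _ ≤ ∑ i, (D.N : ℝ) ^ 2 / (D.n i * D.n i) * D.TW i i ^ 2 *
          (√(4608 / m) * D.traceProd i i) +
        2 * ∑ i, ∑ r with r < i, (D.N : ℝ) ^ 2 / (D.n i * D.n r) * D.TW i r ^ 2 *
          (√(4608 / m) * D.traceProd i r) := by
        rw [integral_add hS3 hS2, integral_const_mul, integral_finsetSum _ fun i _ => hD3 i,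
          integral_finsetSum _ fun i _ => integrable_finsetSum _ fun r hr => hD2 i r hr]
        refine add_le_add (Finset.sum_le_sum fun i _ => ?_) (mul_le_mul_of_nonneg_left
          (Finset.sum_le_sum fun i _ => ?_) zero_le_two)
        · rw [integral_const_mul]
          exact mul_le_mul_of_nonneg_left (h3 i).2 (hc i i)
        · rw [integral_finsetSum _ fun r hr => hD2 i r hr]
          refine Finset.sum_le_sum fun r hr => ?_
          rw [integral_const_mul]
          exact mul_le_mul_of_nonneg_left (h2 i r (Finset.mem_filter.1 hr).2.ne').2 (hc i r)
    _ = _ := by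
        simp only [mul_add, Finset.mul_sum]
        congr 1
        · exact Finset.sum_congr rfl fun i _ => by ring
        · exact Finset.sum_congr rfl fun i _ => Finset.sum_congr rfl fun r _ => by ring

end VarianceEstimator

/-! ### The feasible statistic -/

section Statistics

variable {D : SplitPlotDesign} {Ω : Type*} [MeasurableSpace Ω]
  {X : (i : Fin D.a) → Fin (D.n i) → Ω → EuclideanSpace ℝ (Fin D.d)} {P : Measure Ω}

theorem measurable_Q (D : SplitPlotDesign) : Measurable D.Q := by
  simp only [funext_iff.2 fun x => show D.Q x = (D.N : ℝ) * _ from rfl, stack, groupMean,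
    dotProduct, Matrix.mulVec]
  fun_prop

theorem measurable_W (D : SplitPlotDesign) : Measurable D.W := by
  have h1 : Measurable D.meanEst := by
    refine Finset.measurable_fun_sum _ fun i _ => Measurable.const_mul ?_ _
    simp only [A1_eq]
    exact Measurable.const_mul (Finset.measurable_fun_sum _ fun p _ =>
      measurable_bilin (by fun_prop) (by fun_prop)) _
  have h2 : ∀ i r, Measurable fun x => D.A2 x i r := fun i r => by
    simp only [A2_eq]
    exact Measurable.const_mul (Finset.measurable_fun_sum _ fun p _ =>
      (measurable_bilin (by fun_prop) (by fun_prop)).pow_const 2) _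
  have h3 : ∀ i, Measurable fun x => D.A3 x i := fun i => by
    simp only [A3_eq]
    exact Measurable.const_mul (Finset.measurable_fun_sum _ fun p _ =>
      (measurable_bilin (by fun_prop) (by fun_prop)).pow_const 2) _
  have h4 : Measurable D.A4 :=
    (Finset.measurable_fun_sum _ fun i _ => (h3 i).const_mul _).add
      ((Finset.measurable_fun_sum _ fun i _ => Finset.measurable_fun_sum _ fun r _ =>
        (h2 i r).const_mul _).const_mul 2)
  exact (D.measurable_Q.sub h1).div (h4.const_mul 2).sqrt

theorem IsModel.aemeasurable_data (hX : D.IsModel X P) :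
    AEMeasurable (fun ω => (fun i j => X i j ω : D.Data)) P :=
  aemeasurable_pi_lambda _ fun i => aemeasurable_pi_lambda _ fun j => hX.aemeasurable i j

theorem IsModel.aemeasurable_W (hX : D.IsModel X P) :
    AEMeasurable (fun ω => D.W fun i j => X i j ω) P :=
  D.measurable_W.comp_aemeasurable hX.aemeasurable_data

theorem IsModel.aemeasurable_Wtilde (hX : D.IsModel X P) : AEMeasurable (D.Wtilde X P) P :=
  ((D.measurable_Q.comp_aemeasurable hX.aemeasurable_data).sub_const _).div_const _

/-- Perturbing numerator and squared denominator of a bounded quotient. -/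
theorem abs_div_sqrt_sub_lt {w μ ρ δ K ε : ℝ} (hδ : δ ≤ 1 / 2) (hw : |w| < K)
    (hμ : |μ| < δ) (hρ : |ρ - 1| < δ) (hε : 2 * δ * (K + δ) + δ ≤ ε) :
    |(w - μ) / √ρ - w| < ε := by
  have hρ' := abs_lt.1 hρ
  have hδ0 : 0 < δ := (abs_nonneg _).trans_lt hμ
  have hs : 1 / 2 ≤ √ρ := Real.le_sqrt_of_sq_le (by norm_num; linarith)
  have hs0 : 0 < √ρ := by linarith
  have hs1 : |1 / √ρ - 1| ≤ 2 * δ := by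
    have e : 1 / √ρ - 1 = (1 - ρ) / (√ρ * (1 + √ρ)) := by
      have := Real.sq_sqrt (show 0 ≤ ρ by linarith)
      field_simp
      linear_combination -this
    rw [e, abs_div, abs_of_pos (show 0 < √ρ * (1 + √ρ) by positivity), div_le_iff₀ (by positivity),
      abs_sub_comm]
    have h2 : 1 / 2 ≤ √ρ * (1 + √ρ) := by nlinarith
    have := mul_le_mul_of_nonneg_left h2 (show 0 ≤ 2 * δ by positivity)
    linarith
  have hK : 0 < K := (abs_nonneg _).trans_lt hw
  have h1 : |w - μ| < K + δ := (abs_sub _ _).trans_lt (add_lt_add hw hμ)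
  calc |(w - μ) / √ρ - w| = |(w - μ) * (1 / √ρ - 1) - μ| := by congr 1; ring
    _ ≤ |w - μ| * |1 / √ρ - 1| + |μ| := (abs_sub _ _).trans_eq (by rw [abs_mul])
    _ ≤ (K + δ) * (2 * δ) + |μ| := by gcongr
    _ < ε := by linarith

theorem measureReal_le_abs_le_div_sq [IsProbabilityMeasure P] {Y : Ω → ℝ} (hY : MemLp Y 2 P)
    {c v : ℝ} (hc : 0 < c) (hv : ∫ ω, Y ω ^ 2 ∂P ≤ v) : P.real {ω | c ≤ |Y ω|} ≤ v / c ^ 2 := by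
  have h := mul_meas_ge_le_integral_of_nonneg (μ := P) (f := fun ω => Y ω ^ 2)
    (ae_of_all _ fun ω => sq_nonneg _) hY.integrable_sq (c ^ 2)
  have e : {ω | c ^ 2 ≤ Y ω ^ 2} = {ω | c ≤ |Y ω|} := by
    ext ω
    simp only [Set.mem_ofPred_eq]
    rw [sq_le_sq, abs_of_pos hc]
  rw [e] at h
  rw [le_div_iff₀ (by positivity)]
  linarith

/-- The replacement of the mean and the variance of `Q_N` by their estimators is negligible. The
bound only depends on the minimal group size. -/
theorem IsModel.measureReal_W_sub_Wtilde_le (hX : D.IsModel X P) (h₀ : D.NullHypothesis) {m : ℕ}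
    (hm : 6 ≤ m) (hn : ∀ i, m ≤ D.n i) {δ K ε : ℝ} (hδ0 : 0 < δ) (hδ : δ ≤ 1 / 2) (hK : 0 < K)
    (hε : 2 * δ * (K + δ) + δ ≤ ε) :
    P.real {ω | ε ≤ |D.W (fun i j => X i j ω) - D.Wtilde X P ω|} ≤
      1 / K ^ 2 + (16 / m / δ ^ 2 + √(4608 / m) / δ) := by
  have := hX.indep.isProbabilityMeasure
  have hn0 : ∀ i, 0 < D.n i := fun i => lt_of_lt_of_le (by omega) (hn i)
  set τ := (D.T * D.V * (D.T * D.V)).trace with hτ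
  have hτ0 : 0 < τ := D.trace_T_mul_V_sq_pos hn0
  have hm0 : (0 : ℝ) < m := by exact_mod_cast (show 0 < m by omega)
  have hQ := hX.memLp_two_Q h₀ hn0
  have hEQ := hX.integral_Q h₀ hn0
  have hVQ := hX.variance_Q h₀ hn0
  obtain ⟨hM, hEM, hVM⟩ := hX.meanEst_moments (show 2 ≤ m by omega) hn
  obtain ⟨hA, hEA⟩ := hX.A4_error hm hn
  rw [← hτ] at hVQ hVM hEA
  have hWt : D.Wtilde X P = fun ω =>
      (D.Q (fun i j => X i j ω) - (D.T * D.V).trace) / √(2 * τ) := by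
    ext ω
    rw [Wtilde, hEQ, hVQ]
  set M : Ω → ℝ := fun ω => (D.meanEst (fun i j => X i j ω) - (D.T * D.V).trace) / √(2 * τ)
  have hs := Real.sq_sqrt (show 0 ≤ 2 * τ by positivity)
  have hstd : ∀ {Y : Ω → ℝ}, MemLp Y 2 P → ∫ ω, Y ω ∂P = (D.T * D.V).trace →
      MemLp (fun ω => (Y ω - (D.T * D.V).trace) / √(2 * τ)) 2 P ∧
      ∫ ω, ((Y ω - (D.T * D.V).trace) / √(2 * τ)) ^ 2 ∂P = Var[Y; P] / (2 * τ) := by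
    intro Y hY hE
    refine ⟨?_, ?_⟩
    · simp only [div_eq_mul_inv]
      exact (hY.sub (memLp_const _)).mul_const _
    · simp only [div_pow, hs]
      rw [integral_div, variance_eq_integral hY.aemeasurable, hE]
  obtain ⟨hWL, hW2⟩ := hstd hQ hEQ
  obtain ⟨hML, hM2⟩ := hstd hM hEM
  have h1 : P.real {ω | K ≤ |D.Wtilde X P ω|} ≤ 1 / K ^ 2 := by
    rw [hWt]
    refine measureReal_le_abs_le_div_sq hWL hK (hW2.trans_le ?_)
    rw [hVQ, div_self (by positivity)]
  have h2 : P.real {ω | δ ≤ |M ω|} ≤ 16 / m / δ ^ 2 := by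
    refine measureReal_le_abs_le_div_sq hML hδ0 (hM2.trans_le ?_)
    rw [div_le_iff₀ (by positivity)]
    exact hVM.trans_eq (by ring)
  have h3 : P.real {ω | δ ≤ |D.A4 (fun i j => X i j ω) / τ - 1|} ≤ √(4608 / m) / δ := by
    have hi : Integrable (fun ω => |D.A4 (fun i j => X i j ω) / τ - 1|) P :=
      ((hA.div_const _).sub (integrable_const _)).abs
    have h := mul_meas_ge_le_integral_of_nonneg (μ := P) (ae_of_all _ fun ω => abs_nonneg _) hi δ
    rw [le_div_iff₀ hδ0, mul_comm]
    refine h.trans ?_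
    have e : ∀ ω, |D.A4 (fun i j => X i j ω) / τ - 1| = |D.A4 (fun i j => X i j ω) - τ| / τ := by
      intro ω
      rw [← abs_of_pos hτ0, ← abs_div, abs_of_pos hτ0, sub_div, div_self hτ0.ne']
    simp only [e]
    rw [integral_div, div_le_iff₀ hτ0]
    exact hEA
  have hsub : {ω | ε ≤ |D.W (fun i j => X i j ω) - D.Wtilde X P ω|} ⊆
      {ω | K ≤ |D.Wtilde X P ω|} ∪
        ({ω | δ ≤ |M ω|} ∪ {ω | δ ≤ |D.A4 (fun i j => X i j ω) / τ - 1|}) := by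
    intro ω hω
    by_contra hc
    simp only [Set.mem_union, Set.mem_ofPred_eq, not_or, not_le] at hc
    have hW : D.W (fun i j => X i j ω) =
        (D.Wtilde X P ω - M ω) / √(D.A4 (fun i j => X i j ω) / τ) := by
      have e : D.varEst (fun i j => X i j ω) = 2 * τ * (D.A4 (fun i j => X i j ω) / τ) := by
        rw [varEst]
        field_simp
      rw [W, e, Real.sqrt_mul (by positivity), hWt, ← sub_div, div_div]
      congr 1
      ring
    have := abs_div_sqrt_sub_lt hδ hc.1 hc.2.1 hc.2.2 hε
    rw [← hW] at this
    exact absurd hω (not_le.2 this)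
  calc _ ≤ _ := measureReal_mono hsub
    _ ≤ _ := (measureReal_union_le _ _).trans
      (add_le_add h1 ((measureReal_union_le _ _).trans (add_le_add h2 h3)))

end Statistics

/-! ### Limit distributions -/

section Limit

variable {D : ℕ → SplitPlotDesign} {Ω : ℕ → Type*} [∀ k, MeasurableSpace (Ω k)]
  {P : (k : ℕ) → Measure (Ω k)}
  {X : (k : ℕ) → (i : Fin (D k).a) → Fin ((D k).n i) → Ω k → EuclideanSpace ℝ (Fin (D k).d)}
theorem tendsto_measureReal_W_sub_Wtilde (hn : MinSampleSizeTendsto D)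
    (hX : ∀ k, (D k).IsModel (X k) (P k)) (hH₀ : ∀ k, (D k).NullHypothesis) {ε : ℝ} (hε : 0 < ε) :
    Tendsto (fun k => (P k).real
      {ω | ε ≤ |(D k).W (fun i j => X k i j ω) - (D k).Wtilde (X k) (P k) ω|}) atTop (𝓝 0) := by
  refine Metric.tendsto_atTop'.2 fun η hη => ?_
  -- `K` makes the tail of `W̃` small, `δ` the deviation of `W` from `W̃` off the exceptional set
  obtain ⟨K, hK, hKη⟩ : ∃ K : ℝ, 0 < K ∧ 1 / K ^ 2 < η / 2 := by
    have h : Tendsto (fun K : ℝ => 1 / K ^ 2) atTop (𝓝 0) :=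
      tendsto_const_nhds.div_atTop (tendsto_pow_atTop two_ne_zero)
    obtain ⟨K, h1, h2⟩ :=
      ((h.eventually (gt_mem_nhds (half_pos hη))).and (eventually_gt_atTop 0)).exists
    exact ⟨K, h2, h1⟩
  obtain ⟨δ, hδ0, hδ, hδε⟩ : ∃ δ : ℝ, 0 < δ ∧ δ ≤ 1 / 2 ∧ 2 * δ * (K + δ) + δ ≤ ε := by
    have h : Tendsto (fun δ : ℝ => 2 * δ * (K + δ) + δ) (𝓝[>] 0) (𝓝 0) := by
      have : Continuous fun δ : ℝ => 2 * δ * (K + δ) + δ := by fun_prop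
      simpa using (this.tendsto 0).mono_left nhdsWithin_le_nhds
    have h2 : ∀ᶠ δ in 𝓝[>] (0 : ℝ), δ ∈ Set.Ioc (0 : ℝ) (1 / 2) :=
      Ioc_mem_nhdsGT (by norm_num)
    obtain ⟨δ, h1, h2⟩ := ((h.eventually (gt_mem_nhds hε)).and h2).exists
    exact ⟨δ, h2.1, h2.2, h1.le⟩
  obtain ⟨m, hm, hmη⟩ : ∃ m : ℕ, 6 ≤ m ∧ 16 / (m : ℝ) / δ ^ 2 + √(4608 / m) / δ < η / 2 := by
    have h : Tendsto (fun m : ℕ => 16 / (m : ℝ) / δ ^ 2 + √(4608 / m) / δ) atTop (𝓝 0) := by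
      simpa using ((tendsto_const_div_atTop_nhds_zero_nat 16).div_const (δ ^ 2)).add
        ((tendsto_const_div_atTop_nhds_zero_nat 4608).sqrt.div_const δ)
    obtain ⟨m, h1, h2⟩ :=
      ((h.eventually (gt_mem_nhds (half_pos hη))).and (eventually_ge_atTop 6)).exists
    exact ⟨m, h2, h1⟩
  obtain ⟨k₀, hk₀⟩ := eventually_atTop.1 (hn m)
  refine ⟨k₀, fun k hk => ?_⟩
  have h := (hX k).measureReal_W_sub_Wtilde_le (hH₀ k) hm (hk₀ k hk.le) hδ0 hδ hK hδε
  rw [Real.dist_0_eq_abs, abs_of_nonneg measureReal_nonneg]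
  linarith

variable [∀ k, IsProbabilityMeasure (P k)] {Ω' : Type*} [MeasurableSpace Ω'] {P' : Measure Ω'}
  [IsProbabilityMeasure P']

theorem tendstoInDistribution_W (hn : MinSampleSizeTendsto D)
    (hX : ∀ k, (D k).IsModel (X k) (P k)) (hH₀ : ∀ k, (D k).NullHypothesis) {L : Ω' → ℝ}
    (h : TendstoInDistribution (fun k => (D k).Wtilde (X k) (P k)) atTop L P P') :
    TendstoInDistribution (fun k ω => (D k).W (fun i j => X k i j ω)) atTop L P P' :=
  TendstoInDistribution.of_sub_tendsto_zero h (fun k => (hX k).aemeasurable_W) fun _ hε =>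
    tendsto_measureReal_W_sub_Wtilde hn hX hH₀ hε

theorem tendstoInDistribution_Wtilde_iff (hn : MinSampleSizeTendsto D)
    (hX : ∀ k, (D k).IsModel (X k) (P k)) (hH₀ : ∀ k, (D k).NullHypothesis) {L : Ω' → ℝ}
    (hL : AEMeasurable L P') :
    TendstoInDistribution (fun k => (D k).Wtilde (X k) (P k)) atTop L P P' ↔
      ∀ t, Tendsto (fun k => ∏ s ∈ Finset.range ((D k).a * (D k).d),
        charFun stdChiSq ((D k).beta s * t)) atTop (𝓝 (charFun (P'.map L) t)) := by
  rw [tendstoInDistribution_iff_tendsto_charFun (fun k => (hX k).aemeasurable_Wtilde) hL]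
  refine forall_congr' fun t => tendsto_congr' ?_
  filter_upwards [hn 1] with k hk
  exact (hX k).charFun_map_Wtilde (hH₀ k) hk t

theorem eventually_sum_sq_beta (hn : MinSampleSizeTendsto D) :
    ∀ᶠ k in atTop, ∑ s ∈ Finset.range ((D k).a * (D k).d), (D k).beta s ^ 2 = 1 :=
  (hn 1).mono fun k hk => (D k).sum_sq_beta hk

theorem tendstoInDistribution_Wtilde_gaussian (hn : MinSampleSizeTendsto D)
    (hX : ∀ k, (D k).IsModel (X k) (P k)) (hH₀ : ∀ k, (D k).NullHypothesis)
    (hβ : Tendsto (fun k => (D k).beta 0) atTop (𝓝 0)) :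
    TendstoInDistribution (fun k => (D k).Wtilde (X k) (P k)) atTop (fun z : ℝ => z) P
      (gaussianReal 0 1) := by
  refine (tendstoInDistribution_Wtilde_iff hn hX hH₀ (by fun_prop)).2 fun t => ?_
  have hid : HasLaw (fun x : ℝ => x) stdChiSq stdChiSq := ⟨aemeasurable_id, Measure.map_id⟩
  rw [show (gaussianReal 0 1).map (fun z : ℝ => z) = gaussianReal 0 1 from Measure.map_id]
  refine tendsto_prod_charFun_of_negligible (integral_of_hasLaw_stdChiSq hid)
    (integral_sq_of_hasLaw_stdChiSq hid) _ (fun k s => (D k).beta s) (fun k => (D k).beta 0)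
    (eventually_sum_sq_beta hn) hβ (fun k s => ?_) t
  rw [abs_of_nonneg ((D k).beta_nonneg s)]
  exact (D k).beta_le_beta_zero s

/-- If the standardized eigenvalues converge to the coefficients of a series of unit variance, no
variance is lost in the limit, and `W̃` converges to the sum of the series. -/
theorem tendstoInDistribution_Wtilde_series (hn : MinSampleSizeTendsto D)
    (hX : ∀ k, (D k).IsModel (X k) (P k)) (hH₀ : ∀ k, (D k).NullHypothesis) {b : ℕ → ℝ}
    (hb : HasSum (fun s => b s ^ 2) 1)
    (hβb : ∀ s, Tendsto (fun k => (D k).beta s) atTop (𝓝 (b s)))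
    {Y : ℕ → Ω' → ℝ} (hY : ∀ s, HasLaw (Y s) stdChiSq P') (hYi : iIndepFun Y P') {L : Ω' → ℝ}
    (hL : AEMeasurable L P')
    (hlim : ∀ᵐ ω ∂P', Tendsto (fun m => ∑ s ∈ Finset.range m, b s * Y s ω) atTop (𝓝 (L ω))) :
    TendstoInDistribution (fun k => (D k).Wtilde (X k) (P k)) atTop L P P' := by
  refine (tendstoInDistribution_Wtilde_iff hn hX hH₀ hL).2 fun t => ?_
  have h := (tendstoInMeasure_sum_mul hYi (fun s => memLp_two_of_hasLaw_stdChiSq (hY s))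
    (fun s => integral_of_hasLaw_stdChiSq (hY s)) (fun s => integral_sq_of_hasLaw_stdChiSq (hY s))
    (m := fun k => (D k).a * (D k).d) (β := fun k s => (D k).beta s) (eventually_sum_sq_beta hn)
    (fun k s hs => (D k).beta_eq_zero hs) hb hβb hL hlim)
  have hm : ∀ k, AEMeasurable (fun ω => ∑ s ∈ Finset.range ((D k).a * (D k).d),
      (D k).beta s * Y s ω) P' := fun k =>
    Finset.aemeasurable_fun_sum _ fun s _ => (hY s).aemeasurable.const_mul _
  have h' := (tendstoInDistribution_iff_tendsto_charFun hm hL).1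
    (h.tendstoInDistribution_of_aemeasurable hm hL) t
  refine h'.congr fun k => ?_
  exact charFun_map_sum_mul_eq_prod hYi hY (fun s => (D k).beta s) _ t

/-- The squares of the standardized eigenvalues sum to one, so that a largest one close to `1`
leaves nothing for the others. -/
theorem tendsto_beta_of_tendsto_one (hn : MinSampleSizeTendsto D)
    (hβ : Tendsto (fun k => (D k).beta 0) atTop (𝓝 1)) {s : ℕ} (hs : s ≠ 0) :
    Tendsto (fun k => (D k).beta s) atTop (𝓝 0) := by
  have h1 : Tendsto (fun k => √(1 - (D k).beta 0 ^ 2)) atTop (𝓝 0) := by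
    simpa using ((hβ.pow 2).const_sub 1).sqrt
  refine tendsto_of_tendsto_of_tendsto_of_le_of_le' tendsto_const_nhds h1
    (.of_forall fun k => (D k).beta_nonneg s) ?_
  filter_upwards [eventually_sum_sq_beta hn] with k hk
  by_cases hsk : s < (D k).a * (D k).d
  · refine Real.le_sqrt_of_sq_le ?_
    have h := Finset.sum_le_sum_of_subset_of_nonneg (f := fun l => (D k).beta l ^ 2)
      (show {0, s} ⊆ Finset.range ((D k).a * (D k).d) by
        intro l
        simp only [Finset.mem_insert, Finset.mem_singleton, Finset.mem_range]
        omega) fun l _ _ => sq_nonneg _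
    rw [hk, Finset.sum_pair hs.symm] at h
    linarith
  · rw [(D k).beta_eq_zero (not_lt.1 hsk)]
    exact Real.sqrt_nonneg _

theorem tendstoInDistribution_Wtilde_chiSq (hn : MinSampleSizeTendsto D)
    (hX : ∀ k, (D k).IsModel (X k) (P k)) (hH₀ : ∀ k, (D k).NullHypothesis)
    (hβ : Tendsto (fun k => (D k).beta 0) atTop (𝓝 1)) :
    TendstoInDistribution (fun k => (D k).Wtilde (X k) (P k)) atTop
      (fun c : ℝ => (c - 1) / √2) P chiSqOne := by
  -- an auxiliary space that carries a sequence of independent chi-squared variables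
  let Q : Measure (ℕ → ℝ) := Measure.infinitePi fun _ => chiSqOne
  have hC : ∀ s, HasLaw (fun ω : ℕ → ℝ => ω s) chiSqOne Q := fun s =>
    (measurePreserving_eval_infinitePi (fun _ => chiSqOne) s).hasLaw
  have hCi : iIndepFun (fun (s : ℕ) (ω : ℕ → ℝ) => ω s) Q :=
    iIndepFun_infinitePi (P := fun _ => chiSqOne) (X := fun _ x => x) fun _ => measurable_id
  have hY := fun s => hasLaw_stdChiSq_of_hasLaw_chiSqOne (hC s)
  have hYi : iIndepFun (fun (s : ℕ) (ω : ℕ → ℝ) => (ω s - 1) / √2) Q :=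
    hCi.comp (fun _ c => (c - 1) / √2) fun _ => by fun_prop
  have h := tendstoInDistribution_Wtilde_series (P := P) hn hX hH₀
    (b := fun s => if s = 0 then 1 else 0)
    (by simpa using hasSum_ite_eq (0 : ℕ) (1 : ℝ)) (fun s => by
      by_cases hs : s = 0
      · simpa [hs] using hβ
      · simpa [hs] using tendsto_beta_of_tendsto_one hn hβ hs)
    hY hYi (hY 0).aemeasurable (ae_of_all _ fun ω => by
      refine tendsto_const_nhds.congr' ?_
      filter_upwards [eventually_gt_atTop 0] with m hm
      simp [hm])
  rw [tendstoInDistribution_Wtilde_iff hn hX hH₀ (hY 0).aemeasurable, (hY 0).map_eq] at h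
  exact (tendstoInDistribution_Wtilde_iff hn hX hH₀ (by fun_prop)).2 h

end Limit

end SplitPlotDesign

theorem mainTheorem3
    -- a sequence of designs in one of the three asymptotic frameworks
    (D : ℕ → SplitPlotDesign)
    (hD : FrameworkFixedGroups D ∨ FrameworkFixedDimension D ∨ FrameworkBoth D)
    -- data from the split-plot model, each stage on its own probability space
    {Ω : ℕ → Type*} [∀ k, MeasurableSpace (Ω k)]
    (P : (k : ℕ) → Measure (Ω k)) [∀ k, IsProbabilityMeasure (P k)]
    (X : (k : ℕ) → (i : Fin (D k).a) → Fin ((D k).n i) → Ω k → EuclideanSpace ℝ (Fin (D k).d))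
    (hX : ∀ k, (D k).IsModel (X k) (P k))
    (hH₀ : ∀ k, (D k).NullHypothesis) :
    -- (a)
    (Tendsto (fun k => (D k).beta 0) atTop (𝓝 0) →
      TendstoInDistribution (fun k => (D k).Wtilde (X k) (P k)) atTop
          (fun z : ℝ => z) P (gaussianReal 0 1) ∧
        TendstoInDistribution (fun k ω => (D k).W (fun i j => X k i j ω)) atTop
          (fun z : ℝ => z) P (gaussianReal 0 1)) ∧
    -- (b)
    (Tendsto (fun k => (D k).beta 0) atTop (𝓝 1) →
      TendstoInDistribution (fun k => (D k).Wtilde (X k) (P k)) atTop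
          (fun c : ℝ => (c - 1) / √2) P chiSqOne ∧
        TendstoInDistribution (fun k ω => (D k).W (fun i j => X k i j ω)) atTop
          (fun c : ℝ => (c - 1) / √2) P chiSqOne) ∧
    -- (c)
    (∀ b : ℕ → ℝ, Antitone b → (∀ s, b s ∈ Set.Icc (0 : ℝ) 1) → HasSum (fun s => b s ^ 2) 1 →
      (∀ s, Tendsto (fun k => (D k).beta s) atTop (𝓝 (b s))) →
      ∀ (Ω' : Type*) [MeasurableSpace Ω'] (P' : Measure Ω') [IsProbabilityMeasure P']
        (C : ℕ → Ω' → ℝ), (∀ s, HasLaw (C s) chiSqOne P') → iIndepFun C P' →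
        -- `L` is the sum of the almost surely convergent series `∑ b_s (C_s - 1) / √2`
        ∃ L : Ω' → ℝ,
          (∀ᵐ ω ∂P', Tendsto (fun m => ∑ s ∈ Finset.range m, b s * ((C s ω - 1) / √2)) atTop
            (𝓝 (L ω))) ∧
          TendstoInDistribution (fun k => (D k).Wtilde (X k) (P k)) atTop L P P' ∧
          TendstoInDistribution (fun k ω => (D k).W (fun i j => X k i j ω)) atTop L P P') := by
  have hn : MinSampleSizeTendsto D := by
    rcases hD with h | h | h
    exacts [h.2.2, h.2.2, h.2.2]
  refine ⟨fun hβ => ?_, fun hβ => ?_, fun b _ _ hb hβb Ω' _ P' _ C hC hCi => ?_⟩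
  · have h := SplitPlotDesign.tendstoInDistribution_Wtilde_gaussian hn hX hH₀ hβ
    exact ⟨h, SplitPlotDesign.tendstoInDistribution_W hn hX hH₀ h⟩
  · have h := SplitPlotDesign.tendstoInDistribution_Wtilde_chiSq hn hX hH₀ hβ
    exact ⟨h, SplitPlotDesign.tendstoInDistribution_W hn hX hH₀ h⟩
  · have hY := fun s => hasLaw_stdChiSq_of_hasLaw_chiSqOne (hC s)
    have hYi : iIndepFun (fun s ω => (C s ω - 1) / √2) P' :=
      hCi.comp (fun _ c => (c - 1) / √2) fun _ => by fun_prop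
    obtain ⟨L, hL, hlim⟩ := exists_ae_tendsto_sum_mul hYi
      (fun s => memLp_two_of_hasLaw_stdChiSq (hY s)) (fun s => integral_of_hasLaw_stdChiSq (hY s))
      (fun s => integral_sq_of_hasLaw_stdChiSq (hY s)) hb.summable
    have h := SplitPlotDesign.tendstoInDistribution_Wtilde_series (P := P) hn hX hH₀ hb hβb hY hYi
      hL hlim
    exact ⟨L, hlim, h, SplitPlotDesign.tendstoInDistribution_W hn hX hH₀ h⟩
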